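/- Conventions. All linear maps are bounded. A derivation on a Banach algebra $\mathcal B$ is a bounded linear map $D:\mathcal B\to\mathcal B$ with $D(xy)=D(x)y+xD(y)$. A bounded linear map $\delta:\mathcal B\to\mathcal B$ is an approximately local derivation if for every $a\in\mathcal B$ there is a sequence of derivations $D_{a,k}$ on $\mathcal B$ with $\delta(a)=\lim_k D_{a,k}(a)$. A $C^*$-algebra is residually finite dimensional (RFD) if its finite dimensional $*$-representations separate its points. An automorphic multivariable $C^*$-dynamical system $(\mathcal A,\sigma)$ is a (not necessarily unital) $C^*$-algebra $\mathcal A$ with $*$-automorphisms $\sigma=(\sigma_1,\dots,\sigma_n)$. A contractive covariant representation consists of a $*$-representation $\pi$ of $\mathcal A$ and contractions $T_1,\dots,T_n$ on the same Hilbert space with $\pi(a)T_i=T_i\,\pi(\sigma_i(a))$ for all $a\in\mathcal A$ and all $i$. The semicrossed product $\mathcal A\times_\sigma\mathbb F_n^+$ is the universal operator algebra for these: the completion of the algebra of polynomials $\sum_{w\in\mathbb F_n^+}T_w a_w$ ($a_w\in\mathcal A$) in the supremum of the norms over all contractive covariant representations. The crossed product $\mathcal A\times_\sigma\mathbb F_n$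 is the (full) universal $C^*$-algebra, closed linear span of the elements $U_g a$ ($g\in\mathbb F_n$, $a\in\mathcal A$), for the covariant representations in which $T_1=U_1,\dots,T_n=U_n$ are unitaries. Finally, $A(\mathbb F_n^+)$ is the closed unital non-selfadjoint subalgebra of the full group $C^*$-algebra $C^*(\mathbb F_n)$ generated by the $n$ canonical unitary generators. Proposition. Let $n\ge 0$ be an integer. 1. Let $(\mathcal A,\sigma)$, $\sigma=(\sigma_1,\dots,\sigma_n)$, be an automorphic multivariable $C^*$-dynamical system whose crossed product $\mathcal A\times_\sigma\mathbb F_n$ is residually finite dimensional. Then every approximately local derivation on $\mathcal A\times_\sigma\mathbb F_n^+$ is a derivation. 2. In particular, every approximately local derivation on $A(\mathbb F_n^+)$ is a derivation; likewise every approximately local derivation on the universal unital operator algebra generated by $n$ contractions (the completion of the unital noncommutative polynomials in $n$ variables in the supremum of the norms over all $n$-tuples of Hilbert space contractions) is a derivation. -/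

import Mathlib

open Filter Topology
open scoped ENNReal

universe u

noncomputable section

/-! ### Derivations and approximately local derivations

All linear maps are bounded. -/

section Derivations

variable {B : Type*} [NonUnitalNormedRing B] [NormedSpace ℂ B]

/-- A bounded linear map `D : B → B` is a derivation if it satisfies the Leibniz rule. -/
def IsDerivation (D : B →L[ℂ] B) : Prop :=
  ∀ x y : B, D (x * y) = D x * y + x * D y

/-- `δ` is an approximately local derivation if, at every `a`, the value `δ a` is the limit of
`D k a` for some sequence of derivations `D k`, which may depend on `a`. -/
def IsApproxLocalDerivation (δ : B →L[ℂ] B) : Prop :=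
  ∀ a : B, ∃ D : ℕ → (B →L[ℂ] B),
    (∀ k, IsDerivation (D k)) ∧ Tendsto (fun k => D k a) atTop (𝓝 (δ a))

end Derivations

/-- A `C*`-algebra is residually finite dimensional if its finite dimensional
`*`-representations separate points. -/
def IsRFD (C : Type*) [NonUnitalRing C] [Module ℂ C] [StarRing C] : Prop :=
  ∀ x : C, x ≠ 0 → ∃ (k : ℕ) (ρ : C →⋆ₙₐ[ℂ] Matrix (Fin k) (Fin k) ℂ), ρ x ≠ 0

/-! ### Tuples of contractions and the algebras generated by families of them -/

/-- An `n`-tuple of contractions on a (nonzero) complex Hilbert space. -/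
structure ContractionTuple (n : ℕ) : Type (u + 1) where
  H : Type u
  [normedAddCommGroup : NormedAddCommGroup H]
  [innerProductSpace : InnerProductSpace ℂ H]
  [completeSpace : CompleteSpace H]
  [nontrivial : Nontrivial H]
  T : Fin n → (H →L[ℂ] H)
  norm_le_one : ∀ i, ‖T i‖ ≤ 1

attribute [instance] ContractionTuple.normedAddCommGroup ContractionTuple.innerProductSpace
  ContractionTuple.completeSpace ContractionTuple.nontrivial

namespace ContractionTuple

variable {n : ℕ}

/-- All the operators of the tuple are unitary. -/
def IsUnitary (r : ContractionTuple.{u} n) : Prop :=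
  ∀ i, r.T i ∈ unitary (r.H →L[ℂ] r.H)

/-- The `C*`-algebra of bounded families of operators `(X_j)_j`, with `X_j` acting on the
Hilbert space of the tuple `r j`, under the supremum norm. -/
def Bdd {J : Type*} (r : J → ContractionTuple.{u} n) : Type _ :=
  lp (fun j => (r j).H →L[ℂ] (r j).H) ∞

section BddInstances

variable {J : Type*} (r : J → ContractionTuple.{u} n)

instance : NormedRing (Bdd r) :=
  inferInstanceAs (NormedRing (lp (fun j => (r j).H →L[ℂ] (r j).H) ∞))

instance : NormedAlgebra ℂ (Bdd r) :=
  inferInstanceAs (NormedAlgebra ℂ (lp (fun j => (r j).H →L[ℂ] (r j).H) ∞))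

instance : StarRing (Bdd r) :=
  inferInstanceAs (StarRing (lp (fun j => (r j).H →L[ℂ] (r j).H) ∞))

instance : CStarAlgebra (Bdd r) where
  toCompleteSpace := inferInstanceAs (CompleteSpace (lp (fun j => (r j).H →L[ℂ] (r j).H) ∞))
  toCStarRing := inferInstanceAs (CStarRing (lp (fun j => (r j).H →L[ℂ] (r j).H) ∞))
  toStarModule := inferInstanceAs (StarModule ℂ (lp (fun j => (r j).H →L[ℂ] (r j).H) ∞))

end BddInstances

/-- The `i`-th generator `(T_i^{(j)})_j`: the direct sum of the `i`-th contractions of all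
members of the family. -/
def gen {J : Type*} (r : J → ContractionTuple.{u} n) (i : Fin n) : Bdd r :=
  ⟨fun j => (r j).T i, memℓp_infty ⟨1, by rintro _ ⟨j, rfl⟩; exact (r j).norm_le_one i⟩⟩

end ContractionTuple

open ContractionTuple

/-! ### The universal algebra of `n` contractions, `C*(F_n)` and `A(F_n^+)` -/

/-- The universal unital operator algebra generated by `n` contractions: the closed unital
algebra generated by the direct sum of all `n`-tuples of contractions, so that the norm of a
noncommutative polynomial in the generators is its supremum over all such tuples. -/
def universalContractionAlgebra (n : ℕ) :
    Subalgebra ℂ (Bdd (fun r : ContractionTuple.{0} n => r)) :=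
  (Algebra.adjoin ℂ (Set.range (gen (fun r : ContractionTuple.{0} n => r)))).topologicalClosure

/-- The family of all `n`-tuples of unitaries, i.e. of all unitary representations of the free
group `F_n`. -/
def unitaryTuples (n : ℕ) : {r : ContractionTuple.{0} n // r.IsUnitary} → ContractionTuple.{0} n :=
  Subtype.val

/-- The full group `C*`-algebra `C*(F_n)` of the free group on `n` generators: the `C*`-algebra
generated by the direct sum of all `n`-tuples of unitaries. -/
def freeGroupCStar (n : ℕ) : StarSubalgebra ℂ (Bdd (unitaryTuples n)) :=
  (StarAlgebra.adjoin ℂ (Set.range (gen (unitaryTuples n)))).topologicalClosure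

/-- The canonical unitary generators of `C*(F_n)`. -/
def freeGroupCStarGen (n : ℕ) (i : Fin n) : freeGroupCStar n :=
  ⟨gen (unitaryTuples n) i,
    StarSubalgebra.le_topologicalClosure _ (StarAlgebra.subset_adjoin ℂ _ ⟨i, rfl⟩)⟩

/-- `A(F_n^+)`: the closed unital non-selfadjoint subalgebra of `C*(F_n)` generated by the
canonical generators. -/
def freeSemigroupAlgebra (n : ℕ) : Subalgebra ℂ (freeGroupCStar n) :=
  (Algebra.adjoin ℂ (Set.range (freeGroupCStarGen n))).topologicalClosure

/-! ### Crossed products and semicrossed products of automorphic systems -/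

section Dynamics

variable {n : ℕ} {A : Type u} [NonUnitalCStarAlgebra A]

/-- A contractive covariant representation of the automorphic multivariable system
`(A, σ_1, …, σ_n)`: a `*`-representation `π` of `A` and contractions `T_1, …, T_n` on the same
Hilbert space with `π(a) T_i = T_i π(σ_i(a))`. Hilbert spaces in the universe of `A` suffice to
compute all norms, since they contain every cyclic representation up to unitary equivalence. -/
structure CovariantRep (σ : Fin n → (A ≃⋆ₐ[ℂ] A)) extends ContractionTuple.{u} n where
  π : A →⋆ₙₐ[ℂ] (H →L[ℂ] H)
  covariant : ∀ (i : Fin n) (a : A), π a * T i = T i * π (σ i a)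

variable (σ : Fin n → (A ≃⋆ₐ[ℂ] A))

/-- The copy `a ↦ (π_j(a))_j` of `A` in the direct sum of a family of covariant
representations. -/
def coeffEmb {J : Type*} (r : J → CovariantRep σ) (a : A) :
    Bdd (fun j => (r j).toContractionTuple) :=
  ⟨fun j => (r j).π a, memℓp_infty ⟨‖a‖, by
    rintro _ ⟨j, rfl⟩; exact NonUnitalStarAlgHom.norm_apply_le (r j).π a⟩⟩

/-- The word `T_{i_1} ⋯ T_{i_k}` in the generators, for `w = i_1 ⋯ i_k ∈ F_n^+`. -/
def genWord {J : Type*} (r : J → CovariantRep σ) (w : FreeMonoid (Fin n)) :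
    Bdd (fun j => (r j).toContractionTuple) :=
  FreeMonoid.lift (gen (fun j => (r j).toContractionTuple)) w

/-- The semicrossed product `A ×_σ F_n^+`: the universal operator algebra of the contractive
covariant representations, i.e. the closed algebra generated by the elements `T_w a`
(`w ∈ F_n^+`, `a ∈ A`) in the direct sum of all contractive covariant representations. The norm
of a polynomial `∑ T_w a_w` is its supremum over all contractive covariant representations. -/
def semicrossedProduct :
    NonUnitalSubalgebra ℂ (Bdd (fun r : CovariantRep σ => r.toContractionTuple)) :=
  (NonUnitalAlgebra.adjoin ℂ
    {x | ∃ (w : FreeMonoid (Fin n)) (a : A),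
      x = genWord σ (fun r : CovariantRep σ => r) w *
        coeffEmb σ (fun r : CovariantRep σ => r) a}).topologicalClosure

instance : NormedSpace ℂ (semicrossedProduct σ) :=
  inferInstanceAs (NormedSpace ℂ (semicrossedProduct σ).toSubmodule)

/-- The family of all covariant representations by unitaries. -/
def unitaryReps : {r : CovariantRep σ // r.IsUnitary} → CovariantRep σ :=
  Subtype.val

/-- The (full) crossed product `C*`-algebra `A ×_σ F_n`: the `C*`-algebra generated by the
elements `U_w a` (`w ∈ F_n^+`, `a ∈ A`) in the direct sum of all covariant representations by
unitaries. Because the `U_i` are unitary and the `σ_i` are automorphisms, this is the closed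
linear span of all `U_g a` with `g ∈ F_n` and `a ∈ A`. -/
def crossedProduct :
    NonUnitalStarSubalgebra ℂ (Bdd (fun r => (unitaryReps σ r).toContractionTuple)) :=
  (NonUnitalStarAlgebra.adjoin ℂ
    {x | ∃ (w : FreeMonoid (Fin n)) (a : A),
      x = genWord σ (unitaryReps σ) w * coeffEmb σ (unitaryReps σ) a}).topologicalClosure

end Dynamics

end

/-!
The proof tests everything against traces of finite dimensional representations.

Let `B` be a Banach algebra, `D` a bounded derivation of `B`, and `ρ` a continuous representation of
`B` by `k × k` matrices. Each `exp (t D)` is an automorphism, so `ρ ∘ exp (t D)` is again a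
representation, the spectral radius of `ρ (exp (t D) f)` is at most `‖f‖`, and the entire function
`t ↦ tr ρ (exp (t D) f)` is bounded by `k ‖f‖`. By Liouville's theorem its derivative at `0`
vanishes: `tr ρ (D f) = 0` (`IsDerivation.trace_apply_eq_zero`). No invariance of the kernel of `ρ`
under `D` is needed.

Applied to `f = a²` and `f = a³`, this gives `tr ρ (D a) ρ a = 0` and `tr ρ (D a) ρ a ² = 0`. Both
relations are closed conditions on the value `D a`, so they pass to an approximately local
derivation `δ`. Polarizing and combining them yields `tr ρ (a) ρ (δ (b²) - δ b b - b δ b) = 0` for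
all `a`. If the range of `ρ` is self-adjoint, the trace form on it is nondegenerate; so if such
representations separate the points of `B`, then `δ` is a Jordan derivation. In that case `B` is
also semiprime, and Jordan derivations of 2-torsion free semiprime rings are derivations (Herstein,
Cusack, Brešar; `leibniz_of_jordan`). This is `IsApproxLocalDerivation.isDerivation`, and it remains
to find enough matrix representations with self-adjoint range.

The tool is a unitary dilation (`unitaryDilation`). On `ℓ²(X, H)` with a base point `e` and a
permutation `s`, move the coordinates along `s` and then mix the coordinates `e` and `s e` by the
unitary `R + i √(1 - R²)`, where `R` is the self-adjoint operator matrix with off-diagonal entries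
`T` and `T*`. As `R²` is diagonal, the result is triangular enough for products of such unitaries,
with different `T` and `s`, to compress to the product of the `T`.

For the two universal algebras generated by contractions or unitaries, compress a tuple to a finite
dimensional subspace that contains the orbit of a vector under the words of a given polynomial, and
dilate along a cyclic shift longer than the degree. The resulting finite dimensional unitary tuples
separate points, and an algebra of matrices that contains a unitary contains its inverse, so the
range is self-adjoint.

For the semicrossed product, take `X = F_n` and let `A` act on the coordinate at `g` through the
automorphism belonging to `g`. The dilation of a contractive covariant representation is then a
covariant representation by unitaries, hence the semicrossed product embeds in the crossed product.
A matrix representation `ρ` of the crossed product has the same range on both: multiplication by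
`U_w` preserves the Hilbert-Schmidt norm, so it maps the finite dimensional range of the semicrossed
product onto itself, and together with an approximate unit of `A` this puts `ρ (U_w a)*` into that
range.
-/

noncomputable section

open ContractionTuple

/-! ### Jordan derivations of semiprime rings -/

section JordanDerivations

variable {R : Type*} [NonUnitalRing R] {δ : R →+ R}

theorem jordan_anticomm (hδ : ∀ a, δ (a * a) = δ a * a + a * δ a) (a b : R) :
    δ (a * b + b * a) = δ a * b + a * δ b + δ b * a + b * δ a := by
  have h := hδ (a + b)
  have ha := hδ a
  have hb := hδ b
  simp only [mul_add, add_mul, map_add, ha, hb] at h ⊢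
  rw [← sub_eq_zero] at h ⊢
  rw [← h]
  abel

theorem jordan_sandwich (h2 : ∀ x : R, x + x = 0 → x = 0)
    (hδ : ∀ a, δ (a * a) = δ a * a + a * δ a) (a b : R) :
    δ (a * b * a) = δ a * b * a + a * δ b * a + a * b * δ a := by
  have h := jordan_anticomm hδ a (a * b + b * a)
  have h' := jordan_anticomm hδ (a * a) b
  rw [jordan_anticomm hδ a b] at h
  rw [hδ a] at h'
  rw [← sub_eq_zero]
  apply h2
  simp only [mul_add, add_mul, map_add, mul_assoc] at h h' ⊢
  rw [← sub_eq_zero] at h h'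
  have := congrArg₂ (· - ·) h h'
  simp only [sub_zero] at this
  rw [← this]
  abel

theorem jordan_triple (h2 : ∀ x : R, x + x = 0 → x = 0)
    (hδ : ∀ a, δ (a * a) = δ a * a + a * δ a) (a b c : R) :
    δ (a * b * c + c * b * a) = δ a * b * c + a * δ b * c + a * b * δ c
      + δ c * b * a + c * δ b * a + c * b * δ a := by
  have h := jordan_sandwich h2 hδ (a + c) b
  have ha := jordan_sandwich h2 hδ a b
  have hc := jordan_sandwich h2 hδ c b
  simp only [mul_add, add_mul, map_add, ha, hc] at h ⊢
  rw [← sub_eq_zero] at h ⊢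
  rw [← h]
  abel

/-- The failure of the additive map `δ` to satisfy the Leibniz rule at `(a, b)`. -/
def leibnizDefect (δ : R →+ R) (a b : R) : R := δ (a * b) - δ a * b - a * δ b

/-- Computing `δ (abxba + baxab)` in two ways, as `δ` of a sum of nested sandwiches and of a triple
product, shows that the defect anticommutes with the commutator around any `x`. -/
theorem leibnizDefect_mul_commutator (h2 : ∀ x : R, x + x = 0 → x = 0)
    (hδ : ∀ a, δ (a * a) = δ a * a + a * δ a) (a b x : R) :
    leibnizDefect δ a b * x * (a * b - b * a) + (a * b - b * a) * x * leibnizDefect δ a b = 0 := by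
  have h := jordan_triple h2 hδ (a * b) x (b * a)
  have e : a * b * x * (b * a) + b * a * x * (a * b)
      = a * (b * x * b) * a + b * (a * x * a) * b := by
    simp only [mul_assoc]
  rw [e, map_add, jordan_sandwich h2 hδ a, jordan_sandwich h2 hδ b, jordan_sandwich h2 hδ b,
    jordan_sandwich h2 hδ a] at h
  have h1 : δ (b * a) = δ a * b + a * δ b + δ b * a + b * δ a - δ (a * b) := by
    rw [← jordan_anticomm hδ a b, map_add]; abel
  rw [h1] at h
  unfold leibnizDefect
  rw [← sub_eq_zero] at h
  rw [← h]
  simp only [mul_add, add_mul, mul_sub, sub_mul, mul_assoc]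
  abel

/-- In a 2-torsion free semiprime ring, `u x v + v x u = 0` for all `x` forces `u x v = 0`. -/
theorem mul_mul_eq_zero_of_anticomm (h2 : ∀ x : R, x + x = 0 → x = 0)
    (hs : ∀ a : R, (∀ x, a * x * a = 0) → a = 0) {u v : R}
    (h : ∀ x, u * x * v + v * x * u = 0) (m : R) : u * m * v = 0 := by
  refine hs _ fun n => h2 _ ?_
  have h1 := h (m * v * n * u * m)
  have h2 := h m
  have h3 := h (n * u * m)
  have e : u * m * v * n * (u * m * v) = -(v * m * (u * n * u * m * v)) := by
    rw [eq_neg_iff_add_eq_zero]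
    have := congrArg (· * (n * (u * m * v))) h2
    simpa only [add_mul, zero_mul, mul_assoc] using this
  have e2 : u * n * u * m * v = - (v * n * u * m * u) := by
    rw [eq_neg_iff_add_eq_zero]
    simpa only [mul_assoc] using h3
  have e3 : u * m * v * n * (u * m * v) = - (v * m * v * n * u * m * u) := by
    rw [eq_neg_iff_add_eq_zero]
    simpa only [mul_assoc] using h1
  nth_rewrite 1 [e]
  rw [e3, e2]
  simp only [mul_neg, mul_assoc]
  abel

/-- Brešar's theorem: a Jordan derivation of a 2-torsion free semiprime ring is a derivation. The
defect `X = Δ a b` annihilates all commutators, hence is central, and then `X³ = 0`. -/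
theorem leibniz_of_jordan (h2 : ∀ x : R, x + x = 0 → x = 0)
    (hs : ∀ a : R, (∀ x, a * x * a = 0) → a = 0)
    (hδ : ∀ a, δ (a * a) = δ a * a + a * δ a) (a b : R) :
    δ (a * b) = δ a * b + a * δ b := by
  set Δ := leibnizDefect δ with hΔ
  have addl : ∀ a c b, Δ (a + c) b = Δ a b + Δ c b := by
    intro a c b
    simp only [hΔ, leibnizDefect, add_mul, map_add]; abel
  have addr : ∀ a b d, Δ a (b + d) = Δ a b + Δ a d := by
    intro a b d
    simp only [hΔ, leibnizDefect, mul_add, map_add]; abel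
  have z1 : ∀ a b m, Δ a b * m * (a * b - b * a) = 0 := fun a b m =>
    mul_mul_eq_zero_of_anticomm h2 hs (leibnizDefect_mul_commutator h2 hδ a b) m
  have z1' : ∀ a b m, (a * b - b * a) * m * Δ a b = 0 := fun a b m => by
    have := leibnizDefect_mul_commutator h2 hδ a b m
    rwa [z1 a b m, zero_add] at this
  -- Linearize `Δ a b x [a, b] = 0` in `a`; the cross terms square to zero.
  have z2 : ∀ a b c m, Δ a b * m * (c * b - b * c) = 0 := by
    intro a b c m
    have e : Δ a b * m * (c * b - b * c) = - (Δ c b * m * (a * b - b * a)) := by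
      have := z1 (a + c) b m
      have p := z1 a b m
      have q := z1 c b m
      rw [addl] at this
      simp only [mul_add, add_mul, mul_sub] at this p q ⊢
      rw [eq_neg_iff_add_eq_zero, ← this, ← sub_eq_zero, ← add_zero (0 : R), ← neg_zero]
      nth_rewrite 1 [← p]
      rw [← q]
      abel
    refine hs _ fun n => ?_
    nth_rewrite 2 [e]
    have := z1' c b n
    rw [mul_neg, neg_eq_zero]
    calc _ = Δ a b * m * ((c * b - b * c) * n * Δ c b) * m * (a * b - b * a) := by
          simp only [mul_assoc]
      _ = 0 := by rw [this]; simp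
  have z2' : ∀ a b c m, (c * b - b * c) * m * Δ a b = 0 := by
    intro a b c m
    refine hs _ fun n => ?_
    calc _ = (c * b - b * c) * m * (Δ a b * n * (c * b - b * c)) * m * Δ a b := by
          simp only [mul_assoc]
      _ = 0 := by rw [z2]; simp
  -- The same linearization in `b` separates the two commutator entries completely.
  have z3 : ∀ a b c d m, Δ a b * m * (c * d - d * c) = 0 := by
    intro a b c d m
    have e : Δ a b * m * (c * d - d * c) = - (Δ a d * m * (c * b - b * c)) := by
      have := z2 a (b + d) c m
      have p := z2 a b c m
      have q := z2 a d c m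
      rw [addr] at this
      simp only [mul_add, add_mul, mul_sub] at this p q ⊢
      rw [eq_neg_iff_add_eq_zero, ← this, ← sub_eq_zero, ← add_zero (0 : R), ← neg_zero]
      nth_rewrite 1 [← p]
      rw [← q]
      abel
    refine hs _ fun n => ?_
    nth_rewrite 2 [e]
    rw [mul_neg, neg_eq_zero]
    calc _ = Δ a b * m * ((c * d - d * c) * n * Δ a d) * m * (c * b - b * c) := by
          simp only [mul_assoc]
      _ = 0 := by rw [z2']; simp
  have z4 : ∀ c d, Δ a b * (c * d - d * c) = 0 := by
    intro c d
    refine hs _ fun n => ?_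
    calc _ = (Δ a b * ((c * d - d * c) * n * Δ a b) * (c * d - d * c)) := by
          simp only [mul_assoc]
      _ = 0 := z3 _ _ _ _ _
  have central : ∀ d, Δ a b * d = d * Δ a b := by
    intro d
    rw [← sub_eq_zero]
    refine hs _ fun m => ?_
    have h1 := z3 a b (Δ a b) d (d * m)
    have h2 := z3 a b (Δ a b) d m
    calc _ = Δ a b * (d * m) * (Δ a b * d - d * Δ a b)
          - d * (Δ a b * m * (Δ a b * d - d * Δ a b)) := by
          simp only [sub_mul, mul_assoc]
      _ = 0 := by rw [h1, h2, mul_zero, sub_zero]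
  set X := Δ a b with hX
  set Y := a * b - b * a with hY
  have hXY : X * Y = 0 := z4 a b
  have hYX : Y * X = 0 := by rw [← central, hXY]
  have twoX : X + X = δ Y + (δ b * a - a * δ b) + (b * δ a - δ a * b) := by
    have := jordan_anticomm hδ a b
    rw [map_add, ← sub_eq_zero] at this
    rw [← sub_eq_zero, ← this, hX, hΔ, hY]
    simp only [leibnizDefect, map_sub]
    abel
  have hXδY : X * δ Y = X * X + X * X := by
    have := congrArg (X * ·) twoX
    simp only [mul_add, z4, add_zero] at this
    exact this.symm
  -- Apply the Jordan identity to `XY + YX = 0` and multiply by `X`; what survives is `4 X³`.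
  have cube : X * (X * X) = 0 := by
    have h := jordan_anticomm hδ X Y
    rw [hXY, hYX, add_zero, map_zero] at h
    have h' := congrArg (X * ·) h
    have e1 : X * (δ X * Y) = 0 := by rw [← mul_assoc]; exact z1 a b _
    have e2 : X * (Y * δ X) = 0 := by rw [← mul_assoc, hXY, zero_mul]
    have e3 : X * (δ Y * X) = X * (X * δ Y) := by rw [central (δ Y)]
    simp only [mul_add, mul_zero, e1, e2, e3, hXδY, add_zero, zero_add] at h'
    exact h2 _ (h2 _ h'.symm)
  have sq : X * X = 0 := by
    refine hs _ fun m => ?_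
    calc X * X * m * (X * X) = X * (X * (m * X) * X) := by simp only [mul_assoc]
      _ = X * (X * X) * (m * X) := by
        rw [mul_assoc X (m * X) X, ← central (m * X)]; simp only [mul_assoc]
      _ = 0 := by rw [cube, zero_mul]
  have hX0 : X = 0 := by
    refine hs _ fun m => ?_
    rw [mul_assoc, ← central m, ← mul_assoc, sq, zero_mul]
  rw [hX, hΔ, leibnizDefect, sub_sub, sub_eq_zero] at hX0
  exact hX0

end JordanDerivations

/-! ### Traces of finite dimensional representations kill derivations -/

section Trace

open scoped ComplexOrder

variable {B : Type*} [NonUnitalNormedRing B] [NormedSpace ℂ B]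

open scoped Matrix.Norms.L2Operator in
/-- The eigenvalues of `ρ f` are bounded by `‖f‖`, independently of the norm of `ρ`. -/
theorem norm_trace_apply_le {k : ℕ} (ρ : B →ₙₐ[ℂ] Matrix (Fin k) (Fin k) ℂ)
    (hρ : Continuous ρ) (f : B) : ‖(ρ f).trace‖ ≤ k * ‖f‖ := by
  obtain ⟨C, hC⟩ : ∃ C : ℝ, ∀ x, ‖ρ x‖ ≤ C * ‖x‖ :=
    ⟨_, (⟨(ρ : B →ₗ[ℂ] Matrix (Fin k) (Fin k) ℂ), hρ⟩ :
      B →L[ℂ] Matrix (Fin k) (Fin k) ℂ).le_opNorm⟩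
  have hpow : ∀ N : ℕ, ∃ g : B, ρ g = ρ f ^ (N + 1) ∧ ‖g‖ ≤ ‖f‖ ^ (N + 1) := by
    intro N
    induction N with
    | zero => exact ⟨f, by simp, by simp⟩
    | succ N ih =>
      obtain ⟨g, hg, hn⟩ := ih
      refine ⟨g * f, by rw [map_mul, hg, ← pow_succ], (norm_mul_le _ _).trans ?_⟩
      rw [pow_succ _ (N + 1)]
      gcongr
  -- `‖μ‖ ^ N ≤ K ‖f‖ ^ N` for all `N ≥ 1` forces `‖μ‖ ≤ ‖f‖`, whatever the constant `K`.
  have heig : ∀ μ ∈ spectrum ℂ (ρ f), ‖μ‖ ≤ ‖f‖ := by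
    intro μ hμ
    have hb : ∀ N : ℕ, ‖μ‖ ^ (N + 1)
        ≤ max C 0 * ‖(1 : Matrix (Fin k) (Fin k) ℂ)‖ * ‖f‖ ^ (N + 1) := by
      intro N
      obtain ⟨g, hg, hn⟩ := hpow N
      have h1 := spectrum.norm_le_norm_mul_of_mem (spectrum.pow_mem_pow (ρ f) (N + 1) hμ)
      rw [← hg, norm_pow] at h1
      refine h1.trans ?_
      calc ‖ρ g‖ * ‖(1 : Matrix (Fin k) (Fin k) ℂ)‖
          ≤ (max C 0 * ‖f‖ ^ (N + 1)) * ‖(1 : Matrix (Fin k) (Fin k) ℂ)‖ := by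
            refine mul_le_mul_of_nonneg_right ((hC g).trans ?_) (norm_nonneg _)
            exact mul_le_mul (le_max_left _ _) hn (norm_nonneg _) (le_max_right _ _)
        _ = _ := by ring
    by_contra! hlt
    have hpos : 0 < ‖μ‖ := (norm_nonneg f).trans_lt hlt
    have hr : Tendsto (fun N : ℕ => max C 0 * ‖(1 : Matrix (Fin k) (Fin k) ℂ)‖
        * (‖f‖ / ‖μ‖) ^ (N + 1)) atTop (𝓝 0) := by
      have := ((tendsto_pow_atTop_nhds_zero_of_lt_one (r := ‖f‖ / ‖μ‖) (by positivity)
        ((div_lt_one hpos).2 hlt)).comp (tendsto_add_atTop_nat 1)).const_mul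
        (max C 0 * ‖(1 : Matrix (Fin k) (Fin k) ℂ)‖)
      simpa using this
    obtain ⟨N, hN⟩ := (hr.eventually (gt_mem_nhds one_pos)).exists
    rw [div_pow, ← mul_div_assoc, div_lt_one (by positivity)] at hN
    exact absurd (hb N) (not_le.2 hN)
  rw [Matrix.trace_eq_sum_roots_charpoly]
  refine (norm_multiset_sum_le _).trans ((Multiset.sum_le_card_nsmul _ ‖f‖ ?_).trans ?_)
  · intro r hr
    obtain ⟨μ, hμ, rfl⟩ := Multiset.mem_map.1 hr
    exact heig μ (Matrix.mem_spectrum_iff_isRoot_charpoly.2 (Polynomial.isRoot_of_mem_roots hμ))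
  · rw [nsmul_eq_mul, Multiset.card_map]
    gcongr
    refine (Polynomial.card_roots' _).trans ?_
    rw [Matrix.charpoly_natDegree_eq_dim, Fintype.card_fin]

variable [IsScalarTower ℂ B B] [SMulCommClass ℂ B B]

/-- The exponential of a bounded derivation is multiplicative: the function `s ↦ exp (-sD) (exp (sD)
x * exp (sD) y)` has derivative zero. -/
theorem IsDerivation.exp_smul_mul [CompleteSpace B] {D : B →L[ℂ] B} (hD : IsDerivation D) (t : ℂ)
    (x y : B) : NormedSpace.exp (t • D) (x * y)
      = NormedSpace.exp (t • D) x * NormedSpace.exp (t • D) y := by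
  let : NormedAlgebra ℚ (B →L[ℂ] B) := NormedAlgebra.restrictScalars ℚ ℂ _
  set E : ℂ → B →L[ℂ] B := fun s => NormedSpace.exp (s • D) with hE
  set G : ℂ → B →L[ℂ] B := fun s => NormedSpace.exp (s • (-D)) with hG
  have dE : ∀ s (z : B), HasDerivAt (fun s => E s z) (D (E s z)) s := fun s z => by
    have := (hasDerivAt_exp_smul_const' D s).clm_apply (hasDerivAt_const s z)
    simpa using this
  have dG : ∀ s, HasDerivAt G (G s * (-D)) s := fun s => hasDerivAt_exp_smul_const (-D) s
  have dF : ∀ s, HasDerivAt (fun s => G s (E s x * E s y)) 0 s := fun s => by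
    have h := (ContinuousLinearMap.mul ℂ B).hasDerivAt_of_bilinear (fun _ => dE s x)
      (fun _ => dE s y)
    have h2 := (dG s).clm_apply h
    refine h2.congr_deriv ?_
    simp [hD (E s x) (E s y), add_comm]
    abel
  have hconst := is_const_of_deriv_eq_zero (f := fun s => G s (E s x * E s y))
    (fun s => (dF s).differentiableAt) (fun s => (dF s).deriv) t 0
  have hinv : E t * G t = 1 := by
    have hc : Commute (t • D) (t • (-D)) := by
      rw [smul_neg]; exact (Commute.refl _).neg_right
    rw [hE, hG]
    dsimp only
    rw [← NormedSpace.exp_add_of_commute hc, smul_neg, add_neg_cancel, NormedSpace.exp_zero]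
  have h0 : E 0 = 1 := by simp [hE, NormedSpace.exp_zero]
  have h0' : G 0 = 1 := by simp [hG, NormedSpace.exp_zero]
  simp only [h0, h0', one_apply_eq_self] at hconst
  have := congrArg (E t) hconst
  rw [← mul_apply_eq_comp, hinv] at this
  exact this.symm

/-- The trace of a finite dimensional representation vanishes on the range of every bounded
derivation, because `t ↦ tr ρ (exp (tD) f)` is entire and bounded. -/
theorem IsDerivation.trace_apply_eq_zero [CompleteSpace B] {k : ℕ}
    (ρ : B →ₙₐ[ℂ] Matrix (Fin k) (Fin k) ℂ) (hρ : Continuous ρ) {D : B →L[ℂ] B}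
    (hD : IsDerivation D) (f : B) : (ρ (D f)).trace = 0 := by
  let τ : B →L[ℂ] ℂ :=
    ⟨(Matrix.traceLinearMap (Fin k) ℂ ℂ) ∘ₗ (ρ : B →ₗ[ℂ] Matrix (Fin k) (Fin k) ℂ),
      hρ.matrix_trace⟩
  have hd : ∀ s, HasDerivAt (fun s : ℂ => τ (NormedSpace.exp (s • D) f))
      (τ (NormedSpace.exp (s • D) (D f))) s := fun s => by
    have := ((hasDerivAt_exp_smul_const D s).clm_apply (hasDerivAt_const s f))
    have h2 := τ.hasFDerivAt.comp_hasDerivAt s this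
    refine h2.congr_deriv ?_
    simp
  have hbd : ∀ s : ℂ, ‖τ (NormedSpace.exp (s • D) f)‖ ≤ k * ‖f‖ := fun s => by
    let E : B →L[ℂ] B := NormedSpace.exp (s • D)
    let ρs : B →ₙₐ[ℂ] Matrix (Fin k) (Fin k) ℂ :=
      ρ.comp
        { toFun := E
          map_smul' := fun c x => map_smul E c x
          map_zero' := map_zero E
          map_add' := map_add E
          map_mul' := hD.exp_smul_mul s }
    exact norm_trace_apply_le ρs (hρ.comp E.continuous) f
  have hconst := fun s => Differentiable.apply_eq_apply_of_bounded
    (fun s => (hd s).differentiableAt)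
    (isBounded_iff_forall_norm_le.2 ⟨_, by rintro _ ⟨s, rfl⟩; exact hbd s⟩) s 0
  have h0 := hd 0
  rw [funext hconst] at h0
  have h1 : τ (NormedSpace.exp ((0 : ℂ) • D) (D f)) = 0 := h0.unique (hasDerivAt_const _ _)
  rw [zero_smul, NormedSpace.exp_zero, one_apply_eq_self] at h1
  exact h1

/-- If the matrix representations with self-adjoint range separate the points of a Banach algebra,
then its approximately local derivations are derivations. -/
theorem IsApproxLocalDerivation.isDerivation [CompleteSpace B]
    (hsep : ∀ x : B, x ≠ 0 → ∃ (k : ℕ) (ρ : B →ₙₐ[ℂ] Matrix (Fin k) (Fin k) ℂ),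
      Continuous ρ ∧ (∀ a, ∃ b, ρ b = (ρ a).conjTranspose) ∧ ρ x ≠ 0)
    {δ : B →L[ℂ] B} (hδ : IsApproxLocalDerivation δ) : IsDerivation δ := by
  have key : ∀ (k : ℕ) (ρ : B →ₙₐ[ℂ] Matrix (Fin k) (Fin k) ℂ), Continuous ρ →
      (∀ a, ∃ b, ρ b = (ρ a).conjTranspose) → ∀ b, ρ (δ (b * b) - (δ b * b + b * δ b)) = 0 := by
    intro k ρ hρ hstar b
    have tr2 : ∀ a, (ρ (δ a) * ρ a).trace = 0 := by
      intro a
      obtain ⟨D, hD, hlim⟩ := hδ a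
      have h1 : ∀ m, (ρ (D m a) * ρ a).trace = 0 := by
        intro m
        have := (hD m).trace_apply_eq_zero ρ hρ (a * a)
        rw [hD m a a, map_add, map_mul, map_mul, Matrix.trace_add,
          Matrix.trace_mul_comm (ρ a)] at this
        simpa using this
      have h2 : Tendsto (fun m => (ρ (D m a) * ρ a).trace) atTop (𝓝 (ρ (δ a) * ρ a).trace) := by
        have hc : Continuous fun z : B => (ρ z * ρ a).trace :=
          (hρ.matrix_mul continuous_const).matrix_trace
        exact (hc.tendsto _).comp hlim
      simp only [h1] at h2
      exact (tendsto_nhds_unique h2 tendsto_const_nhds)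
    have tr3 : ∀ a, (ρ (δ a) * (ρ a * ρ a)).trace = 0 := by
      intro a
      obtain ⟨D, hD, hlim⟩ := hδ a
      have h1 : ∀ m, (ρ (D m a) * (ρ a * ρ a)).trace = 0 := by
        intro m
        have := (hD m).trace_apply_eq_zero ρ hρ (a * (a * a))
        rw [hD m a, hD m a] at this
        simp only [map_add, map_mul, mul_add, Matrix.trace_add] at this
        rw [← mul_assoc (ρ a) (ρ (D m a)) (ρ a), Matrix.trace_mul_comm (ρ a * ρ (D m a)) (ρ a),
          ← mul_assoc (ρ a) (ρ a), Matrix.trace_mul_comm _ (ρ (D m a))] at this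
        have h3 : (3 : ℂ) * (ρ (D m a) * (ρ a * ρ a)).trace = 0 := by
          linear_combination this
        simpa using h3
      have h2 : Tendsto (fun m => (ρ (D m a) * (ρ a * ρ a)).trace) atTop
          (𝓝 (ρ (δ a) * (ρ a * ρ a)).trace) := by
        have hc : Continuous fun z : B => (ρ z * (ρ a * ρ a)).trace :=
          (hρ.matrix_mul continuous_const).matrix_trace
        exact (hc.tendsto _).comp hlim
      simp only [h1] at h2
      exact (tendsto_nhds_unique h2 tendsto_const_nhds)
    have pol2 : ∀ a c, (ρ (δ a) * ρ c).trace + (ρ (δ c) * ρ a).trace = 0 := by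
      intro a c
      have h := tr2 (a + c)
      simp only [map_add, mul_add, add_mul, Matrix.trace_add] at h
      linear_combination h - tr2 a - tr2 c
    -- The part of the cubic identity at `b + a` that is linear in `a`.
    have pol3 : ∀ a, (ρ (δ a) * (ρ b * ρ b)).trace + (ρ (δ b) * (ρ a * ρ b)).trace
        + (ρ (δ b) * (ρ b * ρ a)).trace = 0 := by
      intro a
      have h := tr3 (b + a)
      have h' := tr3 (b - a)
      simp only [map_add, map_sub, mul_add, add_mul, mul_sub, sub_mul, Matrix.trace_add,
        Matrix.trace_sub] at h h'
      linear_combination (h - h') / 2 - tr3 a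
    have hz : ∀ a, (ρ a * ρ (δ (b * b) - (δ b * b + b * δ b))).trace = 0 := by
      intro a
      have h := pol2 a (b * b)
      have h' := pol3 a
      rw [map_mul] at h
      simp only [map_add, map_sub, map_mul, mul_add, mul_sub, Matrix.trace_add, Matrix.trace_sub]
      rw [Matrix.trace_mul_comm (ρ a) (ρ (δ (b * b))), ← mul_assoc (ρ a) (ρ (δ b)),
        Matrix.trace_mul_comm (ρ a * ρ (δ b)), ← mul_assoc (ρ a) (ρ b),
        Matrix.trace_mul_comm (ρ a * ρ b), ← mul_assoc (ρ b) (ρ a),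
        Matrix.trace_mul_comm (ρ b * ρ a)]
      linear_combination h - h'
    obtain ⟨c, hc⟩ := hstar (δ (b * b) - (δ b * b + b * δ b))
    have := hz c
    rw [hc] at this
    exact Matrix.trace_conjTranspose_mul_self_eq_zero_iff.1 this
  have jordan : ∀ b, δ (b * b) = δ b * b + b * δ b := by
    intro b
    by_contra hne
    obtain ⟨k, ρ, hρ, hstar, hx⟩ := hsep _ (sub_ne_zero.2 hne)
    exact hx (key k ρ hρ hstar b)
  -- Choose `x` with `ρ x = (ρ a)ᴴ`, so that `ρ a (ρ a)ᴴ ρ a = 0`.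
  have semiprime : ∀ a : B, (∀ x, a * x * a = 0) → a = 0 := by
    intro a ha
    by_contra hne
    obtain ⟨k, ρ, hρ, hstar, hx⟩ := hsep a hne
    obtain ⟨c, hc⟩ := hstar a
    have := congrArg ρ (ha c)
    rw [map_mul, map_mul, hc, map_zero] at this
    apply hx
    have h2 := congrArg ((ρ a).conjTranspose * ·) this
    have h3 : ((ρ a).conjTranspose * ρ a).conjTranspose * ((ρ a).conjTranspose * ρ a) = 0 := by
      simpa [Matrix.conjTranspose_mul, mul_assoc] using h2
    exact Matrix.conjTranspose_mul_self_eq_zero.1 (Matrix.conjTranspose_mul_self_eq_zero.1 h3)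
  intro x y
  exact leibniz_of_jordan (δ := (δ : B →ₗ[ℂ] B).toAddMonoidHom)
    (fun x hx => by
      rw [← two_smul ℂ] at hx
      exact (smul_eq_zero.1 hx).resolve_left two_ne_zero) semiprime jordan x y

end Trace

/-! ### Unitary dilations on ℓ²(X, H) -/

section Dilation

open ContinuousLinearMap

variable {H X : Type*} [NormedAddCommGroup H] [InnerProductSpace ℂ H]

/-- The operator `(W f) x = φ x (f (t x))` on `ℓ²(X, H)`, for a permutation `t` of `X` and a
bounded family `φ` of operators on `H`. -/
def weightedShift (t : Equiv.Perm X) (φ : X → H →L[ℂ] H)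
    (hφ : BddAbove (Set.range fun x => ‖φ x‖)) :
    lp (fun _ : X => H) 2 →L[ℂ] lp (fun _ : X => H) 2 :=
  have hle : ∀ (f : lp (fun _ : X => H) 2) (s : Finset X),
      ∑ x ∈ s, ‖φ x (f (t x))‖ ^ (2 : ℝ≥0∞).toReal
        ≤ ((⨆ x, ‖φ x‖) * ‖f‖) ^ (2 : ℝ≥0∞).toReal := fun f s => by
    have hC : 0 ≤ ⨆ x, ‖φ x‖ := Real.iSup_nonneg fun _ => norm_nonneg _
    calc ∑ x ∈ s, ‖φ x (f (t x))‖ ^ (2 : ℝ≥0∞).toReal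
        ≤ ∑ x ∈ s, ((⨆ x, ‖φ x‖) * ‖f (t x)‖) ^ (2 : ℝ≥0∞).toReal := by
          gcongr with x
          exact (le_opNorm _ _).trans (by gcongr; exact le_ciSup hφ x)
      _ = (⨆ x, ‖φ x‖) ^ (2 : ℝ≥0∞).toReal
            * ∑ x ∈ s.map t.toEmbedding, ‖f x‖ ^ (2 : ℝ≥0∞).toReal := by
          rw [Finset.sum_map, Finset.mul_sum]
          refine Finset.sum_congr rfl fun x _ => ?_
          rw [Real.mul_rpow hC (norm_nonneg _)]
          rfl
      _ ≤ _ := by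
          rw [Real.mul_rpow hC (norm_nonneg _)]
          gcongr
          exact lp.sum_rpow_le_norm_rpow (by simp) f _
  LinearMap.mkContinuous
    { toFun := fun f => ⟨fun x => φ x (f (t x)), memℓp_gen' (hle f)⟩
      map_add' := fun f g => by ext x; exact map_add (φ x) (f (t x)) (g (t x))
      map_smul' := fun c f => by ext x; exact map_smul (φ x) c (f (t x)) }
    (⨆ x, ‖φ x‖) fun f => lp.norm_le_of_forall_sum_le (by simp)
      (mul_nonneg (Real.iSup_nonneg fun _ => norm_nonneg _) (norm_nonneg _)) (hle f)

@[simp]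
theorem weightedShift_apply (t : Equiv.Perm X) (φ : X → H →L[ℂ] H)
    (hφ : BddAbove (Set.range fun x => ‖φ x‖)) (f : lp (fun _ : X => H) 2) (x : X) :
    weightedShift t φ hφ f x = φ x (f (t x)) := rfl

theorem bddAbove_norm_one :
    BddAbove (Set.range fun _ : X => ‖(1 : H →L[ℂ] H)‖) :=
  ⟨‖(1 : H →L[ℂ] H)‖, by rintro _ ⟨_, rfl⟩; rfl⟩

/-- The permutation operator `f ↦ f ∘ s⁻¹`, carrying the coordinate at `x` to the one at `s x`. -/
def permShift (s : Equiv.Perm X) : lp (fun _ : X => H) 2 →L[ℂ] lp (fun _ : X => H) 2 :=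
  weightedShift s.symm (fun _ => 1) bddAbove_norm_one

@[simp]
theorem permShift_apply (s : Equiv.Perm X) (f : lp (fun _ : X => H) 2) (x : X) :
    permShift s f x = f (s.symm x) := rfl

/-- The vectors of `ℓ²(X, H)` that vanish outside `Y`. -/
def supportedIn (Y : Set X) : Submodule ℂ (lp (fun _ : X => H) 2) where
  carrier := {f | ∀ x ∉ Y, f x = 0}
  add_mem' hf hg x hx := by simp [hf x hx, hg x hx]
  zero_mem' x _ := rfl
  smul_mem' c f hf x hx := by simp [hf x hx]

theorem supportedIn_mono {Y Y' : Set X} (h : Y ⊆ Y') :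
    supportedIn (H := H) Y ≤ supportedIn Y' := fun _ hf x hx => hf x fun hx' => hx (h hx')

theorem isClosed_supportedIn (Y : Set X) :
    IsClosed (supportedIn (H := H) Y : Set (lp (fun _ : X => H) 2)) := by
  have : (supportedIn (H := H) Y : Set (lp (fun _ : X => H) 2))
      = ⋂ x ∈ Yᶜ, {f | lp.evalCLM ℂ (fun _ : X => H) 2 x f = 0} := by
    ext f
    simp only [Set.mem_iInter]
    rfl
  rw [this]
  exact isClosed_biInter fun x _ => isClosed_eq (ContinuousLinearMap.continuous _) continuous_const

/-- The pairs of operators on `ℓ²(X, H)` and `H` such that the first is block triangular with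
respect to the coordinate at `e` and those in `Y`, with the second as its diagonal entry at `e`. -/
def triangularPairs {X : Type*} [DecidableEq X] (H : Type*) [NormedAddCommGroup H]
    [InnerProductSpace ℂ H] (e : X) (Y : Set X) :
    Subalgebra ℂ ((lp (fun _ : X => H) 2 →L[ℂ] lp (fun _ : X => H) 2) × (H →L[ℂ] H)) where
  carrier := {p | (∀ f ∈ supportedIn Y, p.1 f ∈ supportedIn Y) ∧
    ∀ h : H, p.1 (lp.single 2 e h) - lp.single 2 e (p.2 h) ∈ supportedIn Y}
  mul_mem' {p q} hp hq := by
    refine ⟨fun f hf => hp.1 _ (hq.1 f hf), fun h => ?_⟩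
    have h1 := hp.1 _ (hq.2 h)
    rw [map_sub] at h1
    have := add_mem h1 (hp.2 (q.2 h))
    rwa [sub_add_sub_cancel] at this
  add_mem' {p q} hp hq := by
    refine ⟨fun f hf => add_mem (hp.1 f hf) (hq.1 f hf), fun h => ?_⟩
    have := add_mem (hp.2 h) (hq.2 h)
    rw [← add_sub_add_comm, ← lp.single_add] at this
    exact this
  algebraMap_mem' c := by
    rw [Algebra.algebraMap_eq_smul_one]
    refine ⟨fun f hf => Submodule.smul_mem _ c hf, fun h => ?_⟩
    change c • lp.single (E := fun _ : X => H) 2 e h - lp.single 2 e (c • h) ∈ _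
    rw [lp.single_smul, sub_self]
    exact zero_mem _

theorem isClosed_triangularPairs [DecidableEq X] (e : X) (Y : Set X) :
    IsClosed (triangularPairs H e Y : Set
      ((lp (fun _ : X => H) 2 →L[ℂ] lp (fun _ : X => H) 2) × (H →L[ℂ] H))) := by
  have h1 : ∀ f : lp (fun _ : X => H) 2, Continuous fun p :
      (lp (fun _ : X => H) 2 →L[ℂ] lp (fun _ : X => H) 2) × (H →L[ℂ] H) => p.1 f := fun f =>
    (ContinuousLinearMap.apply ℂ _ f).continuous.comp continuous_fst
  have h2 : ∀ h : H, Continuous fun p :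
      (lp (fun _ : X => H) 2 →L[ℂ] lp (fun _ : X => H) 2) × (H →L[ℂ] H) => p.2 h := fun h =>
    (ContinuousLinearMap.apply ℂ _ h).continuous.comp continuous_snd
  refine IsClosed.and ?_ ?_
  · simp only [Set.ofPred_forall]
    exact isClosed_iInter fun f => isClosed_iInter fun _ => (isClosed_supportedIn Y).preimage (h1 f)
  · simp only [Set.ofPred_forall]
    exact isClosed_iInter fun h => (isClosed_supportedIn Y).preimage ((h1 _).sub
      ((lp.isometry_single (E := fun _ : X => H) (p := 2) e).continuous.comp (h2 h)))

variable [CompleteSpace H]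

theorem star_weightedShift (t : Equiv.Perm X) (φ ψ : X → H →L[ℂ] H)
    (hφ : BddAbove (Set.range fun x => ‖φ x‖)) (hψ : BddAbove (Set.range fun x => ‖ψ x‖))
    (h : ∀ x, ψ (t x) = star (φ x)) :
    star (weightedShift t φ hφ) = weightedShift t.symm ψ hψ := by
  rw [star_eq_adjoint]
  symm
  rw [eq_adjoint_iff]
  intro f g
  rw [lp.inner_eq_tsum, lp.inner_eq_tsum, ← t.tsum_eq]
  refine tsum_congr fun x => ?_
  rw [weightedShift_apply, weightedShift_apply, h, Equiv.symm_apply_apply, star_eq_adjoint,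
    adjoint_inner_left]

theorem permShift_mem_unitary (s : Equiv.Perm X) :
    permShift s ∈ unitary (lp (fun _ : X => H) 2 →L[ℂ] lp (fun _ : X => H) 2) := by
  have h : star (permShift (H := H) s) = permShift s.symm :=
    star_weightedShift _ _ _ _ _ fun _ => (star_one _).symm
  rw [Unitary.mem_iff, h]
  constructor <;>
  · ext f x
    simp

/-- The operator `R + i √(1 - R²)`, which is unitary if `R` is a self-adjoint contraction. -/
def completeToUnitary (R : H →L[ℂ] H) : H →L[ℂ] H := R + Complex.I • CFC.sqrt (1 - R ^ 2)

theorem completeToUnitary_mem_unitary {R : H →L[ℂ] H} (hR : IsSelfAdjoint R) (hR' : ‖R‖ ≤ 1) :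
    completeToUnitary R ∈ unitary (H →L[ℂ] H) :=
  hR.self_add_I_smul_cfcSqrt_sub_sq_mem_unitary _ hR'

theorem commute_completeToUnitary_sub {R b : H →L[ℂ] H} (h : Commute (R ^ 2) b) :
    Commute (completeToUnitary R - R) b := by
  rw [completeToUnitary, add_sub_cancel_left]
  exact (Commute.cfcₙ_nnreal ((Commute.one_left b).sub_left h) _).smul_left _

theorem commute_completeToUnitary {R b : H →L[ℂ] H} (h : Commute R b) :
    Commute (completeToUnitary R) b := by
  rw [← sub_add_cancel (completeToUnitary R) R]
  exact (commute_completeToUnitary_sub (h.pow_left 2)).add_left h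

variable [DecidableEq X]

/-- The self-adjoint operator on `ℓ²(X, H)` that couples the coordinates `x` and `y` by the
off-diagonal block matrix with entries `T` and `T*`, and vanishes on the other coordinates. -/
def coupling (x y : X) (T : H →L[ℂ] H) : lp (fun _ : X => H) 2 →L[ℂ] lp (fun _ : X => H) 2 :=
  lp.singleContinuousLinearMap ℂ (fun _ : X => H) 2 x ∘L T ∘L lp.evalCLM ℂ (fun _ : X => H) 2 y
    + lp.singleContinuousLinearMap ℂ (fun _ : X => H) 2 y ∘L (star T)
      ∘L lp.evalCLM ℂ (fun _ : X => H) 2 x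

theorem coupling_apply (x y : X) (T : H →L[ℂ] H) (f : lp (fun _ : X => H) 2) :
    coupling x y T f = lp.single 2 x (T (f y)) + lp.single 2 y (star T (f x)) := rfl

theorem isSelfAdjoint_coupling (x y : X) (T : H →L[ℂ] H) : IsSelfAdjoint (coupling x y T) := by
  rw [isSelfAdjoint_iff_isSymmetric]
  intro f g
  simp only [coe_coe, coupling_apply, inner_add_left, inner_add_right, lp.inner_single_left,
    lp.inner_single_right, star_eq_adjoint, adjoint_inner_left, adjoint_inner_right]
  rw [add_comm]

theorem norm_coupling_le {x y : X} (hxy : x ≠ y) {T : H →L[ℂ] H} (hT : ‖T‖ ≤ 1) :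
    ‖coupling x y T‖ ≤ 1 := by
  refine opNorm_le_bound _ zero_le_one fun f => ?_
  rw [one_mul]
  refine le_of_sq_le_sq ?_ (norm_nonneg _)
  have h0 : inner ℂ (lp.single 2 x (T (f y)) : lp (fun _ : X => H) 2)
      (lp.single 2 y (star T (f x))) = 0 := by
    rw [lp.inner_single_left, lp.single_apply_ne _ _ _ hxy, inner_zero_right]
  rw [coupling_apply, sq, norm_add_sq_eq_norm_sq_add_norm_sq_of_inner_eq_zero _ _ h0,
    lp.norm_single (by simp), lp.norm_single (by simp)]
  have hb : ∀ (S : H →L[ℂ] H) (v : H), ‖S‖ ≤ 1 → ‖S v‖ * ‖S v‖ ≤ ‖v‖ ^ 2 := fun S v hS => by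
    rw [sq]
    have := S.le_of_opNorm_le hS v
    rw [one_mul] at this
    gcongr
  have h1 := hb T (f y) hT
  have h2 := hb (star T) (f x) (by rwa [norm_star])
  have h3 := lp.sum_rpow_le_norm_rpow (p := 2) (by simp) f {x, y}
  rw [Finset.sum_pair hxy] at h3
  simp only [ENNReal.toReal_ofNat, Real.rpow_ofNat] at h3
  linarith

theorem coupling_apply_apply {x y : X} (hxy : x ≠ y) (T : H →L[ℂ] H)
    (f : lp (fun _ : X => H) 2) (w : X) :
    coupling x y T f w = if w = x then T (f y) else if w = y then star T (f x) else 0 := by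
  rw [coupling_apply, lp.coeFn_add, Pi.add_apply]
  split_ifs with h1 h2
  · subst h1; rw [lp.single_apply_self, lp.single_apply_ne _ _ _ hxy, add_zero]
  · subst h2; rw [lp.single_apply_self, lp.single_apply_ne _ _ _ h1, zero_add]
  · rw [lp.single_apply_ne _ _ _ h1, lp.single_apply_ne _ _ _ h2, zero_add]

/-- The square of a coupling is diagonal, so the defect part `i √(1 - R²)` acts coordinatewise. -/
theorem completeToUnitary_coupling_apply {x y : X} (hxy : x ≠ y) (T : H →L[ℂ] H)
    (f : lp (fun _ : X => H) 2) (z : X) (hf : f z = 0) :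
    completeToUnitary (coupling x y T) f z = coupling x y T f z := by
  let P : lp (fun _ : X => H) 2 →L[ℂ] lp (fun _ : X => H) 2 :=
    lp.singleContinuousLinearMap ℂ (fun _ : X => H) 2 z ∘L lp.evalCLM ℂ (fun _ : X => H) 2 z
  have hP : ∀ g, P g = lp.single 2 z (g z) := fun _ => rfl
  have hPP : ∀ g w, P g w = if w = z then g z else 0 := fun g w => by
    rw [hP]
    split_ifs with h
    · subst h; rw [lp.single_apply_self]
    · rw [lp.single_apply_ne _ _ _ h]
  have hc : Commute (coupling x y T ^ 2) P := by
    have hyx := hxy.symm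
    ext g w
    simp only [sq, mul_apply_eq_comp, hPP, coupling_apply_apply hxy]
    by_cases hx : z = x
    · subst hx
      by_cases hw : w = z
      · subst hw; simp [hyx]
      · simp [hw, hyx]
    · by_cases hy : z = y
      · subst hy
        by_cases hw : w = z
        · subst hw; simp [hyx]
        · simp [hw, hxy, hyx]
      · simp [Ne.symm hx, Ne.symm hy, hx, hy]
  have h1 := congrArg (fun S => S f z) (commute_completeToUnitary_sub hc).eq
  simp only [mul_apply_eq_comp, hP, hf, lp.single_zero, map_zero, lp.single_apply_self] at h1
  exact sub_eq_zero.1 h1.symm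

/-- The unitary dilation of the contraction `T` attached to a permutation `s` of `X` and a base
point `e`: the coordinates move along `s`, and the coordinates `e` and `s e` are then mixed so
that the compression to the coordinate `e` is `T`. -/
def unitaryDilation (e : X) (s : Equiv.Perm X) (T : H →L[ℂ] H) :
    lp (fun _ : X => H) 2 →L[ℂ] lp (fun _ : X => H) 2 :=
  completeToUnitary (coupling e (s e) T) * permShift s

theorem unitaryDilation_mem_unitary {e : X} {s : Equiv.Perm X} (he : s e ≠ e) {T : H →L[ℂ] H}
    (hT : ‖T‖ ≤ 1) :
    unitaryDilation e s T ∈ unitary (lp (fun _ : X => H) 2 →L[ℂ] lp (fun _ : X => H) 2) :=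
  mul_mem (completeToUnitary_mem_unitary (isSelfAdjoint_coupling _ _ _)
    (norm_coupling_le he.symm hT)) (permShift_mem_unitary s)

/-- On vectors that avoid the coordinates `e` and `s⁻¹ e`, the dilation shifts supports by `s`. -/
theorem unitaryDilation_apply_eq_zero {e : X} {s : Equiv.Perm X} (he : s e ≠ e) (T : H →L[ℂ] H)
    {f : lp (fun _ : X => H) 2} (hf : f e = 0) (hf' : f (s.symm e) = 0) {x : X}
    (hx : f (s.symm x) = 0) : unitaryDilation e s T f x = 0 := by
  rw [unitaryDilation, mul_apply_eq_comp, completeToUnitary_coupling_apply he.symm T _ x hx,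
    coupling_apply_apply he.symm]
  simp [hf, hf']

/-- On the coordinate `e`, the dilation is `T` up to a component in the coordinate `s e`. -/
theorem unitaryDilation_single_apply {e : X} {s : Equiv.Perm X} (he : s e ≠ e)
    (T : H →L[ℂ] H) (h : H) {x : X} (hx : x ≠ s e) :
    (unitaryDilation e s T (lp.single 2 e h)) x
      = (lp.single 2 e (T h) : lp (fun _ : X => H) 2) x := by
  have hs : permShift s (lp.single 2 e h : lp (fun _ : X => H) 2) = lp.single 2 (s e) h := by
    ext y
    by_cases hy : y = s e
    · subst hy; simp
    · rw [permShift_apply, lp.single_apply_ne _ _ _ hy, lp.single_apply_ne]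
      rintro rfl
      simp at hy
  rw [unitaryDilation, mul_apply_eq_comp, hs, completeToUnitary_coupling_apply he.symm T _ x
    (lp.single_apply_ne _ _ _ hx), coupling_apply_apply he.symm]
  split_ifs with h1
  · subst h1; simp
  · rw [lp.single_apply_ne _ _ _ h1]

theorem unitaryDilation_mem_supportedIn {e : X} {s : Equiv.Perm X} (he : s e ≠ e) (T : H →L[ℂ] H)
    {Y Y' : Set X} (h1 : e ∉ Y) (h2 : s.symm e ∉ Y) (h3 : ∀ y ∈ Y, s y ∈ Y')
    {f : lp (fun _ : X => H) 2} (hf : f ∈ supportedIn Y) :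
    unitaryDilation e s T f ∈ supportedIn Y' := fun x hx =>
  unitaryDilation_apply_eq_zero he T (hf _ h1) (hf _ h2) (hf _ fun hx' => hx (by
    simpa using h3 _ hx'))

theorem unitaryDilation_single_sub_mem {e : X} {s : Equiv.Perm X} (he : s e ≠ e) (T : H →L[ℂ] H)
    {Y : Set X} (hY : s e ∈ Y) (h : H) :
    unitaryDilation e s T (lp.single 2 e h) - lp.single 2 e (T h) ∈ supportedIn Y := by
  intro x hx
  have hx' : x ≠ s e := by rintro rfl; exact hx hY
  rw [lp.coeFn_sub, Pi.sub_apply, unitaryDilation_single_apply he T h hx', sub_self]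

end Dilation

/-! ### Finite dimensional unitary dilations of polynomials -/

section FiniteDilation

variable {H : Type*} [NormedAddCommGroup H] [InnerProductSpace ℂ H] {n : ℕ}

/-- The compression of an operator to a finite dimensional subspace. -/
def compression (F : Submodule ℂ H) [FiniteDimensional ℂ F] (T : H →L[ℂ] H) : F →L[ℂ] F :=
  F.orthogonalProjectionOnto ∘L T ∘L F.subtypeL

theorem norm_compression_le (F : Submodule ℂ H) [FiniteDimensional ℂ F] {T : H →L[ℂ] H}
    (hT : ‖T‖ ≤ 1) : ‖compression F T‖ ≤ 1 := by
  refine ContinuousLinearMap.opNorm_le_bound _ zero_le_one fun v => ?_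
  rw [one_mul]
  have h := T.le_of_opNorm_le hT (v : H)
  rw [one_mul] at h
  exact (F.norm_orthogonalProjectionOnto_apply_le _).trans h

/-- The value of a polynomial at a vector `ξ` is computed exactly by the compressions to any finite
dimensional subspace containing suitable finitely many vectors. -/
theorem exists_lift_compression_eq (T : Fin n → (H →L[ℂ] H)) (q : FreeAlgebra ℂ (Fin n)) :
    ∀ ξ : H, ∃ F : Submodule ℂ H, FiniteDimensional ℂ F ∧ ξ ∈ F ∧
      ∀ (F' : Submodule ℂ H) [FiniteDimensional ℂ F'], F ≤ F' → ∀ v : F', (v : H) = ξ →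
        (FreeAlgebra.lift ℂ (fun i => compression F' (T i)) q v : H)
          = FreeAlgebra.lift ℂ T q ξ := by
  induction q using FreeAlgebra.induction with
  | grade0 c =>
    refine fun ξ => ⟨ℂ ∙ ξ, inferInstance, Submodule.mem_span_singleton_self ξ,
      fun F' _ _ v hv => ?_⟩
    rw [AlgHom.commutes, AlgHom.commutes, Algebra.algebraMap_eq_smul_one,
      Algebra.algebraMap_eq_smul_one]
    simp [hv]
  | grade1 i =>
    refine fun ξ => ⟨(ℂ ∙ ξ) ⊔ (ℂ ∙ T i ξ), inferInstance,
      Submodule.mem_sup_left (Submodule.mem_span_singleton_self ξ), fun F' _ hF v hv => ?_⟩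
    rw [FreeAlgebra.lift_ι_apply, FreeAlgebra.lift_ι_apply]
    have : T i v ∈ F' := by
      rw [hv]
      exact hF (Submodule.mem_sup_right (Submodule.mem_span_singleton_self _))
    simp only [compression, ContinuousLinearMap.comp_apply, Submodule.subtypeL_apply]
    rw [← hv]
    exact Submodule.starProjection_eq_self_iff.2 this
  | mul a b ha hb =>
    intro ξ
    obtain ⟨Fb, h1, h2, h3⟩ := hb ξ
    obtain ⟨Fa, h4, h5, h6⟩ := ha (FreeAlgebra.lift ℂ T b ξ)
    refine ⟨Fa ⊔ Fb, inferInstance, Submodule.mem_sup_right h2, fun F' _ hF v hv => ?_⟩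
    rw [map_mul, map_mul, mul_apply_eq_comp, mul_apply_eq_comp]
    exact h6 F' (le_sup_left.trans hF) _ (h3 F' (le_sup_right.trans hF) v hv)
  | add a b ha hb =>
    intro ξ
    obtain ⟨Fb, h1, h2, h3⟩ := hb ξ
    obtain ⟨Fa, h4, h5, h6⟩ := ha ξ
    refine ⟨Fa ⊔ Fb, inferInstance, Submodule.mem_sup_right h2, fun F' _ hF v hv => ?_⟩
    rw [map_add, map_add, add_apply, add_apply,
      Submodule.coe_add, h6 F' (le_sup_left.trans hF) v hv, h3 F' (le_sup_right.trans hF) v hv]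

theorem nontrivial_lp (H X : Type*) [NormedAddCommGroup H] [DecidableEq X] [Nonempty X]
    [Nontrivial H] : Nontrivial (lp (fun _ : X => H) 2) := by
  obtain ⟨v, hv⟩ := exists_ne (0 : H)
  obtain ⟨x⟩ := ‹Nonempty X›
  refine ⟨lp.single 2 x v, 0, fun h => hv ?_⟩
  have := congrArg (fun f : lp (fun _ : X => H) 2 => f x) h
  simpa using this

theorem finiteDimensional_lp (X : Type*) [Finite X] [FiniteDimensional ℂ H] :
    FiniteDimensional ℂ (lp (fun _ : X => H) 2) := by
  let L : lp (fun _ : X => H) 2 →ₗ[ℂ] (X → H) :=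
    { toFun := fun f => f, map_add' := fun _ _ => rfl, map_smul' := fun _ _ => rfl }
  exact FiniteDimensional.of_injective L fun f g h => lp.ext h

variable [CompleteSpace H]

/-- For a polynomial `q`, some `N` bounds its degree in the following sense: on a cycle that is long
enough, the value of `q` at the dilations moves supports in `{1, …, m}` to `{1, …, m + N}`, and on
the coordinate `0` it is the value of `q` at the contractions up to an error supported in `{1, …,
N}`. -/
theorem exists_lift_unitaryDilation_mem (T : Fin n → (H →L[ℂ] H)) (q : FreeAlgebra ℂ (Fin n)) :
    ∃ N : ℕ, ∀ M m : ℕ, 1 ≤ M → m + N ≤ M →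
      (∀ f ∈ supportedIn (H := H) (((↑) : ℕ → ZMod (M + 1)) '' Set.Icc 1 m),
        FreeAlgebra.lift ℂ (fun i => unitaryDilation (0 : ZMod (M + 1)) (Equiv.addRight 1) (T i)) q f
          ∈ supportedIn (((↑) : ℕ → ZMod (M + 1)) '' Set.Icc 1 (m + N))) ∧
      ∀ h : H, FreeAlgebra.lift ℂ
            (fun i => unitaryDilation (0 : ZMod (M + 1)) (Equiv.addRight 1) (T i)) q
            (lp.single 2 0 h) - lp.single 2 0 (FreeAlgebra.lift ℂ T q h)
          ∈ supportedIn (((↑) : ℕ → ZMod (M + 1)) '' Set.Icc 1 N) := by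
  have mono : ∀ {M a b : ℕ}, a ≤ b → supportedIn (H := H) (((↑) : ℕ → ZMod (M + 1)) '' Set.Icc 1 a)
      ≤ supportedIn (((↑) : ℕ → ZMod (M + 1)) '' Set.Icc 1 b) := fun h =>
    supportedIn_mono (Set.image_mono (Set.Icc_subset_Icc_right h))
  induction q using FreeAlgebra.induction with
  | grade0 c =>
    refine ⟨0, fun M m _ _ => ⟨fun f hf => ?_, fun h => ?_⟩⟩
    · rw [AlgHom.commutes, Algebra.algebraMap_eq_smul_one]
      exact Submodule.smul_mem _ _ hf
    · rw [AlgHom.commutes, AlgHom.commutes, Algebra.algebraMap_eq_smul_one,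
        Algebra.algebraMap_eq_smul_one]
      simp [lp.single_smul]
  | grade1 i =>
    refine ⟨1, fun M m hM hm => ⟨fun f hf => ?_, fun h => ?_⟩⟩
    · have hnot : ∀ a ≤ M, (0 : ZMod (M + 1)) ∉ ((↑) : ℕ → ZMod (M + 1)) '' Set.Icc 1 a := by
        rintro a ha ⟨j, ⟨hj1, hj2⟩, hj⟩
        have := Nat.le_of_dvd hj1 ((ZMod.natCast_eq_zero_iff _ _).1 hj)
        omega
      have hstep : ∀ y ∈ ((↑) : ℕ → ZMod (M + 1)) '' Set.Icc 1 m,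
          Equiv.addRight 1 y ∈ ((↑) : ℕ → ZMod (M + 1)) '' Set.Icc 1 (m + 1) := by
        rintro _ ⟨j, ⟨hj1, hj2⟩, rfl⟩
        exact ⟨j + 1, ⟨by omega, by omega⟩, by simp⟩
      rw [FreeAlgebra.lift_ι_apply]
      refine unitaryDilation_mem_supportedIn ?_ _ (hnot m (by omega)) ?_ hstep hf
      · have : Fact (1 < M + 1) := ⟨by omega⟩
        simp
      · -- If `s⁻¹ 0` were in `{1, …, m}`, then `0` would be in `{1, …, m + 1}`.
        intro hmem
        have := hstep _ hmem
        rw [Equiv.apply_symm_apply] at this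
        exact hnot _ hm this
    · rw [FreeAlgebra.lift_ι_apply, FreeAlgebra.lift_ι_apply]
      refine unitaryDilation_single_sub_mem ?_ _ (by exact ⟨1, by simp, by simp⟩) h
      have : Fact (1 < M + 1) := ⟨by omega⟩
      simp
  | mul a b ha hb =>
    obtain ⟨Na, ha⟩ := ha
    obtain ⟨Nb, hb⟩ := hb
    refine ⟨Nb + Na, fun M m hM hm => ⟨fun f hf => ?_, fun h => ?_⟩⟩
    · rw [map_mul, mul_apply_eq_comp, ← add_assoc]
      exact (ha M (m + Nb) hM (by omega)).1 _ ((hb M m hM (by omega)).1 f hf)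
    · rw [map_mul, map_mul, mul_apply_eq_comp, mul_apply_eq_comp]
      have h1 := (hb M 0 hM (by omega)).2 h
      have h2 := (ha M Nb hM (by omega)).1 _ h1
      have h3 := (ha M 0 hM (by omega)).2 (FreeAlgebra.lift ℂ T b h)
      rw [map_sub] at h2
      have := add_mem h2 (mono (by omega : Na ≤ Nb + Na) h3)
      rwa [sub_add_sub_cancel] at this
  | add a b ha hb =>
    obtain ⟨Na, ha⟩ := ha
    obtain ⟨Nb, hb⟩ := hb
    refine ⟨Na + Nb, fun M m hM hm => ⟨fun f hf => ?_, fun h => ?_⟩⟩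
    · rw [map_add, add_apply]
      exact add_mem (mono (by omega) ((ha M m hM (by omega)).1 f hf))
        (mono (by omega) ((hb M m hM (by omega)).1 f hf))
    · rw [map_add, map_add, add_apply, add_apply,
        lp.single_add, add_sub_add_comm]
      exact add_mem (mono (by omega) ((ha M 0 hM (by omega)).2 h))
        (mono (by omega) ((hb M 0 hM (by omega)).2 h))

theorem exists_norm_lift_le_unitaryDilation (T : Fin n → (H →L[ℂ] H))
    (q : FreeAlgebra ℂ (Fin n)) :
    ∃ M : ℕ, 1 ≤ M ∧ ∀ h : H, ‖FreeAlgebra.lift ℂ T q h‖ ≤ ‖FreeAlgebra.lift ℂ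
      (fun i => unitaryDilation (0 : ZMod (M + 1)) (Equiv.addRight 1) (T i)) q
      (lp.single 2 0 h)‖ := by
  obtain ⟨N, hN⟩ := exists_lift_unitaryDilation_mem T q
  refine ⟨N + 1, by omega, fun h => ?_⟩
  have h1 := (hN (N + 1) 0 (by omega) (by omega)).2 h 0 (by
    rintro ⟨j, ⟨hj1, hj2⟩, hj⟩
    have := Nat.le_of_dvd hj1 ((ZMod.natCast_eq_zero_iff _ _).1 hj)
    omega)
  rw [lp.coeFn_sub, Pi.sub_apply, lp.single_apply_self, sub_eq_zero] at h1
  rw [← h1]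
  exact lp.norm_apply_le_norm (by simp) _ _

/-- A tuple of unitaries on a nonzero Hilbert space, as a tuple of contractions. -/
def ContractionTuple.ofUnitary {K : Type u} [NormedAddCommGroup K] [InnerProductSpace ℂ K]
    [CompleteSpace K] [Nontrivial K] (U : Fin n → (K →L[ℂ] K))
    (hU : ∀ i, U i ∈ unitary (K →L[ℂ] K)) : ContractionTuple.{u} n where
  H := K
  T := U
  norm_le_one i := (CStarRing.norm_of_mem_unitary (hU i)).le

/-- The norm of `q(T) ξ` is attained or exceeded by a finite dimensional unitary tuple at a vector
of the same norm. -/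
theorem ContractionTuple.exists_finiteDimensional_unitary (r : ContractionTuple.{u} n)
    (q : FreeAlgebra ℂ (Fin n)) {ξ : r.H} (hξ : ξ ≠ 0) :
    ∃ t : ContractionTuple.{u} n, t.IsUnitary ∧ FiniteDimensional ℂ t.H ∧ ∃ η : t.H, ‖η‖ = ‖ξ‖ ∧
      ‖FreeAlgebra.lift ℂ r.T q ξ‖ ≤ ‖FreeAlgebra.lift ℂ t.T q η‖ := by
  obtain ⟨F, hF, hmem, hcomp⟩ := exists_lift_compression_eq r.T q ξ
  have hnt : Nontrivial F := ⟨⟨ξ, hmem⟩, 0, fun h => hξ (congrArg Subtype.val h)⟩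
  obtain ⟨M, hM, hle⟩ := exists_norm_lift_le_unitaryDilation (fun i => compression F (r.T i)) q
  have : Fact (1 < M + 1) := ⟨by omega⟩
  have hne : Equiv.addRight (1 : ZMod (M + 1)) 0 ≠ 0 := by simp
  have := nontrivial_lp F (ZMod (M + 1))
  have hU := fun i => unitaryDilation_mem_unitary hne (norm_compression_le F (r.norm_le_one i))
  refine ⟨.ofUnitary _ hU, hU, finiteDimensional_lp (H := F) (ZMod (M + 1)),
    lp.single (E := fun _ : ZMod (M + 1) => F) 2 0 ⟨ξ, hmem⟩,
    lp.norm_single (E := fun _ : ZMod (M + 1) => F) (by simp) _ _, ?_⟩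
  rw [← hcomp F le_rfl ⟨ξ, hmem⟩ rfl]
  exact hle ⟨ξ, hmem⟩

end FiniteDilation

/-! ### Algebras generated by contractions -/

section FreeAlgebras

variable {n : ℕ}

/-- Evaluation of a bounded family of operators at the `j`-th tuple. -/
def bddEval {J : Type*} (r : J → ContractionTuple.{u} n) (j : J) :
    Bdd r →⋆ₐ[ℂ] ((r j).H →L[ℂ] (r j).H) where
  toFun x := x.1 j
  map_one' := rfl
  map_mul' _ _ := rfl
  map_zero' := rfl
  map_add' _ _ := rfl
  commutes' _ := rfl
  map_star' _ := rfl

theorem bddEval_gen {J : Type*} (r : J → ContractionTuple.{u} n) (j : J) (i : Fin n) :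
    bddEval r j (gen r i) = (r j).T i := rfl

theorem norm_bddEval_le {J : Type*} (r : J → ContractionTuple.{u} n) (j : J) (x : Bdd r) :
    ‖bddEval r j x‖ ≤ ‖x‖ := NonUnitalStarAlgHom.norm_apply_le (bddEval r j) x

theorem bdd_ext {J : Type*} {r : J → ContractionTuple.{u} n} {x y : Bdd r}
    (h : ∀ j, bddEval r j x = bddEval r j y) : x = y := lp.ext (funext h)

/-- A finite dimensional algebra of operators contains the inverse of each of its unitaries, since
left multiplication by a unitary is injective and hence surjective on it. -/
theorem star_mem_of_mem_unitary {H : Type*} [NormedAddCommGroup H] [InnerProductSpace ℂ H]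
    [CompleteSpace H] [FiniteDimensional ℂ H] {R : Subalgebra ℂ (H →L[ℂ] H)} {U : H →L[ℂ] H}
    (hU : U ∈ unitary (H →L[ℂ] H)) (hUR : U ∈ R) : star U ∈ R := by
  obtain ⟨h1, h2⟩ := Unitary.mem_iff.1 hU
  let L : R →ₗ[ℂ] R := LinearMap.mulLeft ℂ (⟨U, hUR⟩ : R)
  have hinj : Function.Injective L := by
    intro a b hab
    have h := congrArg (fun c : R => star U * (c : H →L[ℂ] H)) hab
    simp only [L, LinearMap.mulLeft_apply, Subalgebra.coe_mul, ← mul_assoc, h1, one_mul] at h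
    exact Subtype.ext h
  obtain ⟨c, hc⟩ := LinearMap.injective_iff_surjective.1 hinj 1
  have hc' : U * (c : H →L[ℂ] H) = 1 := congrArg Subtype.val hc
  have : star U = c := by
    rw [← mul_one (star U), ← hc', ← mul_assoc, h1, one_mul]
  rw [this]
  exact c.2

/-- If a continuous representation on a finite dimensional space takes topological generators to
unitaries, then its range is self-adjoint. -/
theorem exists_apply_eq_star {B H : Type*} [NormedRing B] [NormedAlgebra ℂ B]
    [NormedAddCommGroup H] [InnerProductSpace ℂ H] [CompleteSpace H] [FiniteDimensional ℂ H]
    (ρ : B →ₐ[ℂ] (H →L[ℂ] H)) (hρ : Continuous ρ) (S : Set B)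
    (hS : (Algebra.adjoin ℂ S).topologicalClosure = ⊤)
    (hU : ∀ s ∈ S, ρ s ∈ unitary (H →L[ℂ] H)) (a : B) : ∃ b, ρ b = star (ρ a) := by
  suffices h : a ∈ {a | star (ρ a) ∈ ρ.range} from h
  have hclosed : IsClosed {a | star (ρ a) ∈ ρ.range} := by
    have : IsClosed (ρ.range : Set (H →L[ℂ] H)) :=
      (Subalgebra.toSubmodule ρ.range).closed_of_finiteDimensional
    exact this.preimage (continuous_star.comp hρ)
  have ha : a ∈ (Algebra.adjoin ℂ S).topologicalClosure := hS ▸ Algebra.mem_top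
  refine closure_minimal ?_ hclosed ha
  intro x hx
  induction hx using Algebra.adjoin_induction with
  | mem s hs => exact star_mem_of_mem_unitary (hU s hs) (AlgHom.mem_range_self ρ s)
  | algebraMap c =>
    refine ⟨algebraMap ℂ B (star c), ?_⟩
    exact (AlgHom.commutes ρ _).trans ((AlgHom.commutes ρ c).symm ▸ algebraMap_star_comm c)
  | add x y _ _ hx hy =>
    rw [Set.mem_ofPred_eq, map_add, star_add]
    exact add_mem hx hy
  | mul x y _ _ hx hy =>
    rw [Set.mem_ofPred_eq, map_mul, star_mul]
    exact mul_mem hy hx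

/-- The matrix of an operator on a finite dimensional Hilbert space in an orthonormal basis. -/
def matrixRep (H : Type*) [NormedAddCommGroup H] [InnerProductSpace ℂ H] [FiniteDimensional ℂ H]
    [CompleteSpace H] :
    (H →L[ℂ] H) →⋆ₐ[ℂ] Matrix (Fin (Module.finrank ℂ H)) (Fin (Module.finrank ℂ H)) ℂ where
  toFun A := LinearMap.toMatrixOrthonormal (stdOrthonormalBasis ℂ H) (A : H →ₗ[ℂ] H)
  map_one' := map_one (LinearMap.toMatrixOrthonormal (stdOrthonormalBasis ℂ H))
  map_mul' A B := map_mul (LinearMap.toMatrixOrthonormal (stdOrthonormalBasis ℂ H))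
    (A : H →ₗ[ℂ] H) (B : H →ₗ[ℂ] H)
  map_zero' := map_zero (LinearMap.toMatrixOrthonormal (stdOrthonormalBasis ℂ H))
  map_add' A B := map_add (LinearMap.toMatrixOrthonormal (stdOrthonormalBasis ℂ H))
    (A : H →ₗ[ℂ] H) (B : H →ₗ[ℂ] H)
  commutes' c := by
    rw [Algebra.algebraMap_eq_smul_one, Algebra.algebraMap_eq_smul_one]
    exact (map_smul (LinearMap.toMatrixOrthonormal (stdOrthonormalBasis ℂ H)) c
      (1 : H →ₗ[ℂ] H)).trans
      (congrArg (c • ·) (map_one (LinearMap.toMatrixOrthonormal (stdOrthonormalBasis ℂ H))))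
  map_star' A := by
    rw [← map_star]
    rfl

theorem matrixRep_injective (H : Type*) [NormedAddCommGroup H] [InnerProductSpace ℂ H]
    [FiniteDimensional ℂ H] [CompleteSpace H] : Function.Injective (matrixRep H) := fun _ _ h =>
  ContinuousLinearMap.coe_injective
    ((LinearMap.toMatrixOrthonormal (stdOrthonormalBasis ℂ H)).injective h)

theorem continuous_matrixRep (H : Type*) [NormedAddCommGroup H] [InnerProductSpace ℂ H]
    [FiniteDimensional ℂ H] [CompleteSpace H] : Continuous (matrixRep H) :=
  (((matrixRep H : (H →L[ℂ] H) →ₐ[ℂ] Matrix (Fin (Module.finrank ℂ H))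
    (Fin (Module.finrank ℂ H)) ℂ)).toLinearMap).continuous_of_finiteDimensional

/-- A Banach algebra topologically generated by `n` elements, realized isometrically on a family of
`n`-tuples of contractions that contains all unitary tuples. -/
theorem IsApproxLocalDerivation.isDerivation_of_adjoin {B J : Type*} [NormedRing B]
    [NormedAlgebra ℂ B] [CompleteSpace B] (r : J → ContractionTuple.{u} n)
    (hr : ∀ t : ContractionTuple.{u} n, t.IsUnitary → ∃ j, r j = t)
    (ψ : B →ₐ[ℂ] Bdd r) (hψ : ∀ x, ‖ψ x‖ = ‖x‖) (g : Fin n → B) (hg : ∀ i, ψ (g i) = gen r i)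
    (hdense : (Algebra.adjoin ℂ (Set.range g)).topologicalClosure = ⊤)
    {δ : B →L[ℂ] B} (hδ : IsApproxLocalDerivation δ) : IsDerivation δ := by
  have hev : ∀ j x, ‖bddEval r j (ψ x)‖ ≤ ‖x‖ := fun j x =>
    (norm_bddEval_le r j _).trans (hψ x).le
  refine hδ.isDerivation fun x hx => ?_
  obtain ⟨j, hj⟩ : ∃ j, bddEval r j (ψ x) ≠ 0 := by
    by_contra! h
    have h0 : ψ x = 0 := bdd_ext h
    exact hx (norm_eq_zero.1 (by rw [← hψ, h0, norm_zero]))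
  obtain ⟨ξ, hξ⟩ : ∃ ξ, bddEval r j (ψ x) ξ ≠ 0 := by
    by_contra! h
    exact hj (ContinuousLinearMap.ext h)
  have hξ0 : ξ ≠ 0 := by rintro rfl; exact hξ (map_zero _)
  have hξpos : 0 < ‖ξ‖ := norm_pos_iff.2 hξ0
  obtain ⟨p, hp, hxp⟩ := Metric.mem_closure_iff.1
    (show x ∈ closure (Algebra.adjoin ℂ (Set.range g) : Set B) from
      (hdense ▸ Algebra.mem_top : x ∈ (Algebra.adjoin ℂ (Set.range g)).topologicalClosure))
    (‖bddEval r j (ψ x) ξ‖ / (2 * ‖ξ‖)) (div_pos (norm_pos_iff.2 hξ) (by positivity))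
  rw [dist_eq_norm, lt_div_iff₀ (by positivity)] at hxp
  rw [SetLike.mem_coe, Algebra.adjoin_range_eq_range_freeAlgebra_lift] at hp
  obtain ⟨q, rfl⟩ := hp
  change ‖x - FreeAlgebra.lift ℂ g q‖ * (2 * ‖ξ‖) < _ at hxp
  have hq : ∀ j, bddEval r j (ψ (FreeAlgebra.lift ℂ g q)) = FreeAlgebra.lift ℂ (r j).T q := by
    intro j
    have : (((bddEval r j : Bdd r →ₐ[ℂ] _).comp ψ).comp (FreeAlgebra.lift ℂ g))
        = FreeAlgebra.lift ℂ (r j).T := by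
      ext i
      simp [hg, bddEval_gen]
    exact congrArg (fun f => f q) this
  -- `x` and the polynomial `q` are so close that `q` cannot be large in a tuple where `x` vanishes.
  obtain ⟨t, htU, htfd, η, hη, hle⟩ := (r j).exists_finiteDimensional_unitary q hξ0
  obtain ⟨l, rfl⟩ := hr t htU
  have hl : bddEval r l (ψ x) ≠ 0 := by
    intro h0
    have hd : ∀ k (v : (r k).H), ‖bddEval r k (ψ x) v - bddEval r k (ψ (FreeAlgebra.lift ℂ g q)) v‖
        ≤ ‖x - FreeAlgebra.lift ℂ g q‖ * ‖v‖ := fun k v => by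
      have := (bddEval r k (ψ (x - FreeAlgebra.lift ℂ g q))).le_of_opNorm_le (hev k _) v
      rwa [map_sub, map_sub, sub_apply] at this
    have h1 := hd j ξ
    have h2 := hd l η
    rw [h0, hη, zero_apply, zero_sub, norm_neg] at h2
    rw [← hq, ← hq] at hle
    have h3 := norm_sub_norm_le (bddEval r j (ψ x) ξ) (bddEval r j (ψ (FreeAlgebra.lift ℂ g q)) ξ)
    linarith
  let ρ : B →ₐ[ℂ] ((r l).H →L[ℂ] (r l).H) := (bddEval r l : Bdd r →ₐ[ℂ] _).comp ψ
  have hρ : Continuous ρ := AddMonoidHomClass.continuous_of_bound ρ 1 fun x => by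
    rw [one_mul]; exact hev l x
  let ρ' : B →ₐ[ℂ] Matrix (Fin (Module.finrank ℂ (r l).H)) (Fin (Module.finrank ℂ (r l).H)) ℂ :=
    (matrixRep (r l).H : _ →ₐ[ℂ] _).comp ρ
  have hρ' : Continuous ρ' := (continuous_matrixRep _).comp hρ
  refine ⟨Module.finrank ℂ (r l).H, AlgHom.toNonUnitalAlgHom ρ', hρ', fun a => ?_, fun h => hl ?_⟩
  · obtain ⟨b, hb⟩ := exists_apply_eq_star ρ hρ (Set.range g) hdense (by
      rintro _ ⟨i, rfl⟩
      change bddEval r l (ψ (g i)) ∈ _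
      rw [hg]
      exact htU i) a
    exact ⟨b, (congrArg (matrixRep (r l).H) hb).trans (map_star (matrixRep (r l).H) (ρ a))⟩
  · exact matrixRep_injective _ (h.trans (map_zero _).symm)

theorem topologicalClosure_adjoin_range_eq_top {E ι : Type*} [NormedRing E] [NormedAlgebra ℂ E]
    (g : ι → E) (g' : ι → (Algebra.adjoin ℂ (Set.range g)).topologicalClosure)
    (h : ∀ i, (g' i : E) = g i) :
    (Algebra.adjoin ℂ (Set.range g')).topologicalClosure = ⊤ := by
  refine eq_top_iff.2 fun x _ => ?_
  have hmap := AlgHom.map_adjoin (Algebra.adjoin ℂ (Set.range g)).topologicalClosure.val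
    (Set.range g')
  rw [← Set.range_comp, show (Algebra.adjoin ℂ (Set.range g)).topologicalClosure.val ∘ g' = g from
    funext h] at hmap
  have hx : (x : E) ∈ closure (Algebra.adjoin ℂ (Set.range g) : Set E) := x.2
  exact closure_subtype.2
    ((congrArg (fun R : Subalgebra ℂ E => (x : E) ∈ closure (R : Set E)) hmap).mpr hx)

theorem universalContractionAlgebra_isDerivation
    {δ : universalContractionAlgebra n →L[ℂ] universalContractionAlgebra n}
    (hδ : IsApproxLocalDerivation δ) : IsDerivation δ := by
  have : CompleteSpace (universalContractionAlgebra n) :=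
    (Subalgebra.isClosed_topologicalClosure _).completeSpace_coe
  exact hδ.isDerivation_of_adjoin (fun r : ContractionTuple.{0} n => r) (fun t _ => ⟨t, rfl⟩)
    (universalContractionAlgebra n).val (fun _ => rfl)
    (fun i => ⟨gen (fun r : ContractionTuple.{0} n => r) i,
      Subalgebra.le_topologicalClosure _ (Algebra.subset_adjoin (by exact ⟨i, rfl⟩))⟩) (fun _ => rfl)
    (topologicalClosure_adjoin_range_eq_top _ _ fun _ => rfl)

theorem freeSemigroupAlgebra_isDerivation
    {δ : freeSemigroupAlgebra n →L[ℂ] freeSemigroupAlgebra n}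
    (hδ : IsApproxLocalDerivation δ) : IsDerivation δ := by
  have : CompleteSpace (freeGroupCStar n) :=
    (StarSubalgebra.isClosed_topologicalClosure _).completeSpace_coe
  have : CompleteSpace (freeSemigroupAlgebra n) :=
    (Subalgebra.isClosed_topologicalClosure _).completeSpace_coe
  let ψ : freeSemigroupAlgebra n →ₐ[ℂ] Bdd (unitaryTuples n) :=
    ((freeGroupCStar n).subtype : freeGroupCStar n →ₐ[ℂ] Bdd (unitaryTuples n)).comp
      (freeSemigroupAlgebra n).val
  have hψ : ∀ x, ‖ψ x‖ = ‖x‖ := fun _ => rfl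
  let g : Fin n → freeSemigroupAlgebra n := fun i => ⟨freeGroupCStarGen n i,
    Subalgebra.le_topologicalClosure _ (Algebra.subset_adjoin (by exact ⟨i, rfl⟩))⟩
  have hg : ∀ i, ψ (g i) = gen (unitaryTuples n) i := fun _ => rfl
  have hd : (Algebra.adjoin ℂ (Set.range g)).topologicalClosure = ⊤ :=
    topologicalClosure_adjoin_range_eq_top _ _ fun _ => rfl
  exact hδ.isDerivation_of_adjoin (unitaryTuples n) (fun t ht => ⟨⟨t, ht⟩, rfl⟩) ψ hψ g hg hd

end FreeAlgebras

/-! ### Unitary dilation of contractive covariant representations -/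

section CovariantDilation

variable {n : ℕ} {A : Type u} [NonUnitalCStarAlgebra A] {σ : Fin n → (A ≃⋆ₐ[ℂ] A)}

theorem commute_coupling_weightedShift {H X : Type*} [NormedAddCommGroup H] [InnerProductSpace ℂ H]
    [CompleteSpace H] [DecidableEq X] {x y : X} (hxy : x ≠ y) (T : H →L[ℂ] H) (φ : X → H →L[ℂ] H)
    (hφ : BddAbove (Set.range fun x => ‖φ x‖)) (h1 : φ x * T = T * φ y)
    (h2 : φ y * star T = star T * φ x) :
    Commute (coupling x y T) (weightedShift 1 φ hφ) := by
  ext f z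
  change coupling x y T (weightedShift 1 φ hφ f) z = φ z (coupling x y T f z)
  rw [coupling_apply_apply hxy, coupling_apply_apply hxy]
  by_cases hx : z = x
  · subst hx
    rw [if_pos rfl, if_pos rfl]
    exact congrArg (fun S => S (f y)) h1.symm
  · by_cases hy : z = y
    · subst hy
      rw [if_neg hx, if_pos rfl, if_neg hx, if_pos rfl]
      exact congrArg (fun S => S (f x)) h2.symm
    · rw [if_neg hx, if_neg hy, if_neg hx, if_neg hy, map_zero]

/-- The action of the free group in which the `i`-th generator acts by `σ_i⁻¹`. -/
def freeAction (σ : Fin n → (A ≃⋆ₐ[ℂ] A)) : FreeGroup (Fin n) →* (A ≃⋆ₐ[ℂ] A) :=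
  FreeGroup.lift fun i => (σ i)⁻¹

theorem freeAction_inv_of_mul (i : Fin n) (g : FreeGroup (Fin n)) (a : A) :
    (freeAction σ (FreeGroup.of i * g))⁻¹ a = (freeAction σ g)⁻¹ (σ i a) := by
  rw [map_mul, mul_inv_rev, freeAction, FreeGroup.lift_apply_of, inv_inv]
  rfl

variable {H : Type u} [NormedAddCommGroup H] [InnerProductSpace ℂ H] [CompleteSpace H]

theorem bddAbove_norm_twisted (σ : Fin n → (A ≃⋆ₐ[ℂ] A)) (π : A →⋆ₙₐ[ℂ] (H →L[ℂ] H)) (a : A) :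
    BddAbove (Set.range fun g : FreeGroup (Fin n) => ‖π ((freeAction σ g)⁻¹ a)‖) := by
  refine ⟨‖a‖, ?_⟩
  rintro _ ⟨g, rfl⟩
  exact (NonUnitalStarAlgHom.norm_apply_le π _).trans
    (NonUnitalStarAlgHom.norm_apply_le ((freeAction σ g)⁻¹) a)

/-- The representation of `A` on `ℓ²(F_n, H)` acting on the coordinate at `g` by `π` twisted by the
automorphism belonging to `g`. -/
def twistedRep (σ : Fin n → (A ≃⋆ₐ[ℂ] A)) (π : A →⋆ₙₐ[ℂ] (H →L[ℂ] H)) :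
    A →⋆ₙₐ[ℂ]
      (lp (fun _ : FreeGroup (Fin n) => H) 2 →L[ℂ] lp (fun _ : FreeGroup (Fin n) => H) 2) where
  toFun a := weightedShift 1 (fun g => π ((freeAction σ g)⁻¹ a)) (bddAbove_norm_twisted σ π a)
  map_smul' c a := by
    ext f g
    simp [weightedShift_apply]
  map_zero' := by
    ext f g
    simp [weightedShift_apply]
  map_add' a b := by
    ext f g
    simp [weightedShift_apply]
  map_mul' a b := by
    ext f g
    simp [weightedShift_apply]
  map_star' a := by
    symm
    exact star_weightedShift 1 _ _ _ _ fun g => by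
      rw [← map_star, ← map_star]; rfl

theorem twistedRep_apply (π : A →⋆ₙₐ[ℂ] (H →L[ℂ] H)) (a : A)
    (f : lp (fun _ : FreeGroup (Fin n) => H) 2) (g : FreeGroup (Fin n)) :
    twistedRep σ π a f g = π ((freeAction σ g)⁻¹ a) (f g) := rfl

/-- The exponent sum of a word of the free group. -/
def exponentSum (n : ℕ) : FreeGroup (Fin n) →* Multiplicative ℤ :=
  FreeGroup.lift fun _ => Multiplicative.ofAdd 1

theorem exponentSum_of_mul (i : Fin n) (g : FreeGroup (Fin n)) :
    (exponentSum n (FreeGroup.of i * g)).toAdd = 1 + (exponentSum n g).toAdd := by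
  simp [exponentSum]

theorem mulLeft_of_one_ne (i : Fin n) :
    Equiv.mulLeft (FreeGroup.of i) 1 ≠ (1 : FreeGroup (Fin n)) := by
  intro h
  change FreeGroup.of i * 1 = 1 at h
  have := exponentSum_of_mul i (1 : FreeGroup (Fin n))
  rw [h] at this
  simp at this

/-- The covariance relation survives in the dilation: `twistedRep` commutes with the coupling of the
coordinates `1` and `i`, and the shift by `i` changes the twist by `σ_i`. -/
theorem twistedRep_mul_unitaryDilation (π : A →⋆ₙₐ[ℂ] (H →L[ℂ] H)) (i : Fin n) {T : H →L[ℂ] H}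
    (hT : ∀ a, π a * T = T * π (σ i a)) (a : A) :
    twistedRep σ π a * unitaryDilation 1 (Equiv.mulLeft (FreeGroup.of i)) T
      = unitaryDilation 1 (Equiv.mulLeft (FreeGroup.of i)) T * twistedRep σ π (σ i a) := by
  have hc : Commute (coupling 1 (Equiv.mulLeft (FreeGroup.of i) 1) T) (twistedRep σ π a) := by
    have h1 : ∀ b, (freeAction σ (1 : FreeGroup (Fin n)))⁻¹ b = b := fun b => by
      rw [map_one, inv_one]; rfl
    have h2 : ∀ b, (freeAction σ (Equiv.mulLeft (FreeGroup.of i) 1))⁻¹ b = σ i b := fun b => by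
      exact (freeAction_inv_of_mul i 1 b).trans (h1 _)
    refine commute_coupling_weightedShift (mulLeft_of_one_ne i).symm T _
      (bddAbove_norm_twisted σ π a) ?_ ?_
    · rw [h1, h2, hT]
    · rw [h1, h2]
      have := congrArg star (hT (star a))
      rw [star_mul, star_mul, ← map_star, ← map_star, ← map_star, star_star] at this
      exact this.symm
  have hs : permShift (Equiv.mulLeft (FreeGroup.of i)) * twistedRep σ π (σ i a)
      = twistedRep σ π a * permShift (Equiv.mulLeft (FreeGroup.of i)) := by
    ext f g
    rw [mul_apply_eq_comp, mul_apply_eq_comp, permShift_apply, twistedRep_apply, twistedRep_apply,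
      permShift_apply, ← freeAction_inv_of_mul]
    simp
  rw [unitaryDilation, mul_assoc, hs, ← mul_assoc, ← mul_assoc,
    (commute_completeToUnitary hc).eq]

/-- The unitary dilation of a contractive covariant representation. -/
def CovariantRep.dilation (r : CovariantRep σ) : CovariantRep σ :=
  have := nontrivial_lp r.H (FreeGroup (Fin n))
  { ContractionTuple.ofUnitary
      (fun i => unitaryDilation (1 : FreeGroup (Fin n)) (Equiv.mulLeft (FreeGroup.of i)) (r.T i))
      (fun i => unitaryDilation_mem_unitary (mulLeft_of_one_ne i) (r.norm_le_one i)) with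
    π := twistedRep σ r.π
    covariant := fun i a => twistedRep_mul_unitaryDilation r.π i (r.covariant i) a }

theorem CovariantRep.isUnitary_dilation (r : CovariantRep σ) : r.dilation.IsUnitary := fun i =>
  unitaryDilation_mem_unitary (mulLeft_of_one_ne i) (r.norm_le_one i)

/-- The elements of the free group with positive exponent sum. -/
def positiveCone (n : ℕ) : Set (FreeGroup (Fin n)) := {g | 0 < (exponentSum n g).toAdd}

theorem mem_positiveCone {g : FreeGroup (Fin n)} :
    g ∈ positiveCone n ↔ 0 < (exponentSum n g).toAdd := Iff.rfl

/-- Evaluation of an element of the universal algebra in the dilation of `r`. -/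
def bddEvalDilation (r : CovariantRep σ) :
    Bdd (fun r : CovariantRep σ => r.toContractionTuple) →⋆ₐ[ℂ]
    (lp (fun _ : FreeGroup (Fin n) => r.H) 2 →L[ℂ] lp (fun _ : FreeGroup (Fin n) => r.H) 2) :=
  bddEval (fun r : CovariantRep σ => r.toContractionTuple) r.dilation

/-- Evaluation of an element of the universal algebra in the dilation of `r` and in `r` itself. -/
def dilationEval (r : CovariantRep σ) : Bdd (fun r : CovariantRep σ => r.toContractionTuple) →ₐ[ℂ]
    (lp (fun _ : FreeGroup (Fin n) => r.H) 2 →L[ℂ] lp (fun _ : FreeGroup (Fin n) => r.H) 2) ×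
      (r.H →L[ℂ] r.H) :=
  AlgHom.prod (bddEvalDilation r).toAlgHom
    (bddEval (fun r : CovariantRep σ => r.toContractionTuple) r).toAlgHom

theorem continuous_dilationEval (r : CovariantRep σ) : Continuous (dilationEval r) :=
  Continuous.prodMk
    (AddMonoidHomClass.continuous_of_bound (bddEvalDilation r) 1
      fun x => by rw [one_mul]; exact NonUnitalStarAlgHom.norm_apply_le (bddEvalDilation r) x)
    (AddMonoidHomClass.continuous_of_bound
      (bddEval (fun r : CovariantRep σ => r.toContractionTuple) r) 1
      fun x => by rw [one_mul]; exact norm_bddEval_le _ _ x)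

theorem one_notMem_positiveCone : (1 : FreeGroup (Fin n)) ∉ positiveCone n := by
  rw [mem_positiveCone, map_one]; simp

theorem dilationEval_gen_mem (r : CovariantRep σ) (i : Fin n) :
    dilationEval r (gen (fun r : CovariantRep σ => r.toContractionTuple) i)
      ∈ triangularPairs r.H 1 (positiveCone n) := by
  have hp : ∀ g ∈ positiveCone n, Equiv.mulLeft (FreeGroup.of i) g ∈ positiveCone n := by
    intro g hg
    rw [mem_positiveCone] at hg ⊢
    rw [Equiv.coe_mulLeft, exponentSum_of_mul]
    omega
  refine ⟨fun f hf => ?_, fun h => ?_⟩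
  · refine unitaryDilation_mem_supportedIn (mulLeft_of_one_ne i) (r.T i) ?_ ?_ hp hf
    · exact one_notMem_positiveCone
    · intro h
      have := hp _ h
      rw [Equiv.apply_symm_apply] at this
      exact one_notMem_positiveCone this
  · refine unitaryDilation_single_sub_mem (mulLeft_of_one_ne i) (r.T i) ?_ h
    rw [mem_positiveCone, Equiv.coe_mulLeft, exponentSum_of_mul, map_one]; simp

theorem dilationEval_coeffEmb_mem (r : CovariantRep σ) (a : A) :
    dilationEval r (coeffEmb σ (fun r : CovariantRep σ => r) a)
      ∈ triangularPairs r.H 1 (positiveCone n) := by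
  refine ⟨fun f hf g hg => ?_, fun h => ?_⟩
  · refine (twistedRep_apply r.π a f g).trans ?_
    rw [hf g hg, map_zero]
  · have : twistedRep σ r.π a (lp.single 2 1 h) = lp.single 2 1 (r.π a h) := by
      ext g
      rw [twistedRep_apply]
      by_cases hg : g = 1
      · subst hg
        rw [lp.single_apply_self, lp.single_apply_self, map_one, inv_one]; rfl
      · rw [lp.single_apply_ne _ _ _ hg, lp.single_apply_ne _ _ _ hg, map_zero]
    have h0 : twistedRep σ r.π a (lp.single 2 1 h) - lp.single 2 1 (r.π a h)
        ∈ supportedIn (H := r.H) (positiveCone n) := by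
      rw [this, sub_self]; exact zero_mem _
    exact h0

/-- The block triangular form of the dilation on the generators persists on the whole semicrossed
product, as it is stable under sums, products and limits. -/
theorem dilationEval_mem (r : CovariantRep σ)
    {x : Bdd (fun r : CovariantRep σ => r.toContractionTuple)} (hx : x ∈ semicrossedProduct σ) :
    dilationEval r x ∈ triangularPairs r.H 1 (positiveCone n) := by
  have hcl : IsClosed {x | dilationEval r x ∈ triangularPairs r.H 1 (positiveCone n)} :=
    (isClosed_triangularPairs (H := r.H) 1 (positiveCone n)).preimage (continuous_dilationEval r)
  refine closure_minimal (fun y hy => ?_) hcl hx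
  induction hy using NonUnitalAlgebra.adjoin_induction with
  | mem y hy =>
    obtain ⟨w, a, rfl⟩ := hy
    rw [Set.mem_ofPred_eq, map_mul]
    refine mul_mem ?_ (dilationEval_coeffEmb_mem r a)
    induction w using FreeMonoid.inductionOn with
    | one => rw [genWord, map_one, map_one]; exact one_mem _
    | of i => rw [genWord, FreeMonoid.lift_eval_of]; exact dilationEval_gen_mem r i
    | mul v w hv hw =>
      rw [genWord, map_mul, map_mul]
      exact mul_mem hv hw
  | add x y _ _ hx hy =>
    rw [Set.mem_ofPred_eq, map_add]
    exact add_mem hx hy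
  | zero =>
    rw [Set.mem_ofPred_eq, map_zero]
    exact zero_mem _
  | mul x y _ _ hx hy =>
    rw [Set.mem_ofPred_eq, map_mul]
    exact mul_mem hx hy
  | smul c x _ hx =>
    rw [Set.mem_ofPred_eq, map_smul]
    exact Subalgebra.smul_mem _ hx c

/-- An element of the semicrossed product that vanishes in the unitary dilation of `r` vanishes
in `r`. -/
theorem bddEval_eq_zero_of_dilation (r : CovariantRep σ)
    {x : Bdd (fun r : CovariantRep σ => r.toContractionTuple)} (hx : x ∈ semicrossedProduct σ)
    (h : bddEval (fun r : CovariantRep σ => r.toContractionTuple) r.dilation x = 0) :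
    bddEval (fun r : CovariantRep σ => r.toContractionTuple) r x = 0 := by
  ext v
  have h1 := (dilationEval_mem r hx).2 v 1 one_notMem_positiveCone
  have h2 : (dilationEval r x).1 = 0 := h
  rw [h2, zero_apply, zero_sub, lp.coeFn_neg, Pi.neg_apply, lp.single_apply_self, neg_eq_zero] at h1
  exact h1

end CovariantDilation

/-! ### Matrix representations of the semicrossed product -/

section Semicrossed

variable {n : ℕ} {A : Type u} [NonUnitalCStarAlgebra A] {σ : Fin n → (A ≃⋆ₐ[ℂ] A)}

/-- Two linear maps into matrices with `F(x)ᴴ F(x) = G(x)ᴴ G(x)` have the same kernel, hence ranges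
of the same finite dimension. -/
theorem LinearMap.range_eq_of_conjTranspose_mul_self_eq {V : Type*} [AddCommGroup V] [Module ℂ V]
    {k : ℕ} (F G : V →ₗ[ℂ] Matrix (Fin k) (Fin k) ℂ) (hle : LinearMap.range F ≤ LinearMap.range G)
    (h : ∀ x, (F x).conjTranspose * F x = (G x).conjTranspose * G x) :
    LinearMap.range F = LinearMap.range G := by
  open scoped ComplexOrder in
  have hker : LinearMap.ker F = LinearMap.ker G := by
    ext x
    rw [LinearMap.mem_ker, LinearMap.mem_ker, ← Matrix.conjTranspose_mul_self_eq_zero, h,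
      Matrix.conjTranspose_mul_self_eq_zero]
  refine Submodule.eq_of_le_of_finrank_eq hle ?_
  rw [← F.quotKerEquivRange.finrank_eq, ← G.quotKerEquivRange.finrank_eq, hker]

/-- Restriction of bounded families to the covariant representations by unitaries. -/
def unitaryRestriction (σ : Fin n → (A ≃⋆ₐ[ℂ] A)) :
    Bdd (fun r : CovariantRep σ => r.toContractionTuple) →⋆ₐ[ℂ]
      Bdd (fun r => (unitaryReps σ r).toContractionTuple) where
  toFun x := ⟨fun j => x.1 j.1, memℓp_infty ⟨‖x‖, by
    rintro _ ⟨j, rfl⟩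
    exact norm_bddEval_le (fun r : CovariantRep σ => r.toContractionTuple) j.1 x⟩⟩
  map_one' := rfl
  map_mul' _ _ := rfl
  map_zero' := rfl
  map_add' _ _ := rfl
  commutes' _ := rfl
  map_star' _ := rfl

theorem unitaryRestriction_coeffEmb (a : A) :
    unitaryRestriction σ (coeffEmb σ (fun r : CovariantRep σ => r) a)
      = coeffEmb σ (unitaryReps σ) a := rfl

theorem unitaryRestriction_genWord (w : FreeMonoid (Fin n)) :
    unitaryRestriction σ (genWord σ (fun r : CovariantRep σ => r) w)
      = genWord σ (unitaryReps σ) w := by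
  induction w using FreeMonoid.inductionOn with
  | one => rw [genWord, genWord, map_one, map_one, map_one]
  | of i => rw [genWord, genWord, FreeMonoid.lift_eval_of, FreeMonoid.lift_eval_of]; rfl
  | mul v w hv hw =>
    have h1 : genWord σ (fun r : CovariantRep σ => r) (v * w) = genWord σ (fun r => r) v
      * genWord σ (fun r => r) w := map_mul _ v w
    have h2 : genWord σ (unitaryReps σ) (v * w) = genWord σ (unitaryReps σ) v
      * genWord σ (unitaryReps σ) w := map_mul _ v w
    rw [h1, h2, map_mul, hv, hw]

theorem continuous_unitaryRestriction : Continuous (unitaryRestriction σ) :=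
  AddMonoidHomClass.continuous_of_bound (unitaryRestriction σ) 1
      fun x => by rw [one_mul]; exact NonUnitalStarAlgHom.norm_apply_le (unitaryRestriction σ) x

theorem genWord_mul_coeffEmb_mem (w : FreeMonoid (Fin n)) (a : A) :
    genWord σ (fun r : CovariantRep σ => r) w * coeffEmb σ (fun r : CovariantRep σ => r) a
      ∈ semicrossedProduct σ :=
  NonUnitalSubalgebra.le_topologicalClosure _ (NonUnitalAlgebra.subset_adjoin ℂ ⟨w, a, rfl⟩)

theorem coeffEmb_mem_semicrossedProduct (a : A) :
    coeffEmb σ (fun r : CovariantRep σ => r) a ∈ semicrossedProduct σ := by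
  have := genWord_mul_coeffEmb_mem (σ := σ) 1 a
  rwa [genWord, map_one, one_mul] at this

theorem unitaryRestriction_mem {x : Bdd (fun r : CovariantRep σ => r.toContractionTuple)}
    (hx : x ∈ semicrossedProduct σ) : unitaryRestriction σ x ∈ crossedProduct σ := by
  have hcl : IsClosed {x | unitaryRestriction σ x ∈ crossedProduct σ} :=
    (NonUnitalStarSubalgebra.isClosed_topologicalClosure _).preimage continuous_unitaryRestriction
  refine closure_minimal (fun y hy => ?_) hcl hx
  induction hy using NonUnitalAlgebra.adjoin_induction with
  | mem y hy =>
    obtain ⟨w, a, rfl⟩ := hy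
    refine NonUnitalStarSubalgebra.le_topologicalClosure _
      (NonUnitalStarAlgebra.subset_adjoin ℂ _ ⟨w, a, ?_⟩)
    rw [map_mul, unitaryRestriction_genWord, unitaryRestriction_coeffEmb]
  | add x y _ _ hx hy =>
    rw [Set.mem_ofPred_eq, map_add]
    exact add_mem hx hy
  | zero =>
    rw [Set.mem_ofPred_eq, map_zero]
    exact zero_mem _
  | mul x y _ _ hx hy =>
    rw [Set.mem_ofPred_eq, map_mul]
    exact mul_mem hx hy
  | smul c x _ hx =>
    rw [Set.mem_ofPred_eq, map_smul]
    exact SMulMemClass.smul_mem c hx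

theorem genWord_mul_mem (w : FreeMonoid (Fin n))
    {x : Bdd (fun r : CovariantRep σ => r.toContractionTuple)} (hx : x ∈ semicrossedProduct σ) :
    genWord σ (fun r : CovariantRep σ => r) w * x ∈ semicrossedProduct σ := by
  have hcl : IsClosed {x | genWord σ (fun r : CovariantRep σ => r) w * x ∈ semicrossedProduct σ} :=
    (NonUnitalSubalgebra.isClosed_topologicalClosure _).preimage (continuous_const_mul _)
  refine closure_minimal (fun y hy => ?_) hcl hx
  induction hy using NonUnitalAlgebra.adjoin_induction with
  | mem y hy =>
    obtain ⟨v, a, rfl⟩ := hy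
    have h1 : genWord σ (fun r : CovariantRep σ => r) (w * v) = genWord σ (fun r => r) w
      * genWord σ (fun r => r) v := map_mul _ w v
    rw [Set.mem_ofPred_eq, ← mul_assoc, ← h1]
    exact genWord_mul_coeffEmb_mem _ _
  | add x y _ _ hx hy =>
    rw [Set.mem_ofPred_eq, mul_add]
    exact add_mem hx hy
  | zero =>
    rw [Set.mem_ofPred_eq, mul_zero]
    exact zero_mem _
  | mul x y _ hy' hx hy =>
    rw [Set.mem_ofPred_eq, ← mul_assoc]
    exact mul_mem hx (NonUnitalSubalgebra.le_topologicalClosure _ hy')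
  | smul c x _ hx =>
    rw [Set.mem_ofPred_eq, mul_smul_comm]
    exact SMulMemClass.smul_mem c hx

/-- The semicrossed product embeds in the crossed product. -/
theorem unitaryRestriction_ne_zero {x : Bdd (fun r : CovariantRep σ => r.toContractionTuple)}
    (hx : x ∈ semicrossedProduct σ) (h0 : x ≠ 0) : unitaryRestriction σ x ≠ 0 := by
  intro h
  refine h0 (bdd_ext fun r => ?_)
  rw [map_zero]
  refine bddEval_eq_zero_of_dilation r hx ?_
  exact congrArg (fun y => bddEval (fun r => (unitaryReps σ r).toContractionTuple)
    ⟨r.dilation, r.isUnitary_dilation⟩ y) h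

theorem star_genWord_mul_self (w : FreeMonoid (Fin n)) :
    star (genWord σ (unitaryReps σ) w) * genWord σ (unitaryReps σ) w = 1 := by
  have : genWord σ (unitaryReps σ) w
      ∈ unitary (Bdd (fun r => (unitaryReps σ r).toContractionTuple)) := by
    induction w using FreeMonoid.inductionOn with
    | one => rw [genWord, map_one]; exact one_mem _
    | of i =>
      rw [genWord, FreeMonoid.lift_eval_of, Unitary.mem_iff]
      exact ⟨bdd_ext fun r => (Unitary.mem_iff.1 (r.2 i)).1,
        bdd_ext fun r => (Unitary.mem_iff.1 (r.2 i)).2⟩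
    | mul v w hv hw =>
      rw [genWord, map_mul]
      exact mul_mem hv hw
  exact (Unitary.mem_iff.1 this).1

theorem coeffEmb_mul {J : Type*} (r : J → CovariantRep σ) (a b : A) :
    coeffEmb σ r (a * b) = coeffEmb σ r a * coeffEmb σ r b :=
  bdd_ext fun j => map_mul (r j).π a b

theorem coeffEmb_star {J : Type*} (r : J → CovariantRep σ) (a : A) :
    coeffEmb σ r (star a) = star (coeffEmb σ r a) :=
  bdd_ext fun j => map_star (r j).π a

/-- Coefficients can be moved past a word at the cost of an automorphism of `A`. -/
theorem exists_coeffEmb_mul_genWord {J : Type*} (r : J → CovariantRep σ) (w : FreeMonoid (Fin n)) :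
    ∃ τ : A ≃⋆ₐ[ℂ] A, ∀ a, coeffEmb σ r a * genWord σ r w = genWord σ r w * coeffEmb σ r (τ a) := by
  induction w using FreeMonoid.inductionOn with
  | one => exact ⟨1, fun a => by rw [genWord, map_one, mul_one, one_mul]; rfl⟩
  | of i => exact ⟨σ i, fun a => bdd_ext fun j => (r j).covariant i a⟩
  | mul v w hv hw =>
    obtain ⟨τ, hτ⟩ := hv
    obtain ⟨τ', hτ'⟩ := hw
    refine ⟨τ' * τ, fun a => ?_⟩
    have h1 : genWord σ r (v * w) = genWord σ r v * genWord σ r w := map_mul _ v w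
    rw [h1, ← mul_assoc, hτ, mul_assoc, hτ', ← mul_assoc]
    rfl

open scoped Matrix.Norms.L2Operator in
theorem continuous_toMatrix {C : Type*} [NonUnitalCStarAlgebra C] {k : ℕ}
    (ρ : C →⋆ₙₐ[ℂ] Matrix (Fin k) (Fin k) ℂ) : Continuous ρ :=
  AddMonoidHomClass.continuous_of_bound ρ 1
      fun x => by rw [one_mul]; exact NonUnitalStarAlgHom.norm_apply_le ρ x

variable {k : ℕ}

/-- The restriction to the semicrossed product of a matrix representation of the crossed
product. -/
def semicrossedRep (ρ : crossedProduct σ →⋆ₙₐ[ℂ] Matrix (Fin k) (Fin k) ℂ) :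
    semicrossedProduct σ →ₙₐ[ℂ] Matrix (Fin k) (Fin k) ℂ where
  toFun x := ρ ⟨unitaryRestriction σ x, unitaryRestriction_mem x.2⟩
  map_smul' c x := by
    rw [← map_smul]
    congr 1
  map_zero' := by
    rw [← map_zero ρ]
    congr 1
  map_add' x y := by
    rw [← map_add]
    congr 1
  map_mul' x y := by
    rw [← map_mul]
    congr 1

theorem semicrossedRep_apply (ρ : crossedProduct σ →⋆ₙₐ[ℂ] Matrix (Fin k) (Fin k) ℂ)
    (x : semicrossedProduct σ) :
    semicrossedRep ρ x = ρ ⟨unitaryRestriction σ x, unitaryRestriction_mem x.2⟩ := rfl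

theorem continuous_semicrossedRep (ρ : crossedProduct σ →⋆ₙₐ[ℂ] Matrix (Fin k) (Fin k) ℂ) :
    Continuous (semicrossedRep ρ) := by
  have hcl : IsClosed
      (crossedProduct σ : Set (Bdd (fun r => (unitaryReps σ r).toContractionTuple))) :=
    NonUnitalStarSubalgebra.isClosed_topologicalClosure _
  have hρ : Continuous ρ := continuous_toMatrix ρ
  exact hρ.comp ((continuous_unitaryRestriction.comp continuous_subtype_val).subtype_mk _)

/-- Since multiplication by `U_w` maps the range `R` of the semicrossed product onto itself, any
element of `R` is of the form `ρ (U_w y)`, and `ρ (U_w a)ᴴ ρ (U_w y) = ρ (a* y)` is in `R`. -/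
theorem conjTranspose_genWord_mul_mem_range
    (ρ : crossedProduct σ →⋆ₙₐ[ℂ] Matrix (Fin k) (Fin k) ℂ) (w : FreeMonoid (Fin n)) (a : A)
    (x : semicrossedProduct σ) :
    ∃ y, semicrossedRep ρ y = (semicrossedRep ρ ⟨_, genWord_mul_coeffEmb_mem w a⟩).conjTranspose
      * semicrossedRep ρ x := by
  let L : semicrossedProduct σ →ₗ[ℂ] semicrossedProduct σ :=
    { toFun := fun x => ⟨genWord σ (fun r => r) w * x, genWord_mul_mem w x.2⟩
      map_add' := fun x y => Subtype.ext (mul_add _ _ _)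
      map_smul' := fun c x => Subtype.ext (mul_smul_comm _ _ _) }
  let G : semicrossedProduct σ →ₗ[ℂ] Matrix (Fin k) (Fin k) ℂ := (semicrossedRep ρ : _ →ₗ[ℂ] _)
  have hG : ∀ x, G x = ρ ⟨unitaryRestriction σ x, unitaryRestriction_mem x.2⟩ := fun _ => rfl
  have hU : ∀ x : semicrossedProduct σ, unitaryRestriction σ (L x : Bdd _)
      = genWord σ (unitaryReps σ) w * unitaryRestriction σ (x : Bdd _) := fun x => by
    rw [← unitaryRestriction_genWord, ← map_mul]
    rfl
  have hrange : LinearMap.range (G ∘ₗ L) = LinearMap.range G := by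
    refine LinearMap.range_eq_of_conjTranspose_mul_self_eq _ _ (LinearMap.range_comp_le_range _ _)
      fun x => ?_
    rw [LinearMap.comp_apply, hG, hG, ← Matrix.star_eq_conjTranspose, ← Matrix.star_eq_conjTranspose,
      ← map_star, ← map_star, ← map_mul, ← map_mul]
    congr 1
    refine Subtype.ext ?_
    change star (unitaryRestriction σ (L x : Bdd _)) * unitaryRestriction σ (L x : Bdd _)
      = star (unitaryRestriction σ (x : Bdd _)) * unitaryRestriction σ (x : Bdd _)
    rw [hU, star_mul, mul_assoc, ← mul_assoc (star (genWord _ _ _)), star_genWord_mul_self, one_mul]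
  -- By surjectivity, `ρ x` can be rewritten as `ρ (U_w y)`, which absorbs `U_w*`.
  obtain ⟨y, hy⟩ : G x ∈ LinearMap.range (G ∘ₗ L) := hrange ▸ LinearMap.mem_range_self G x
  refine ⟨⟨coeffEmb σ (fun r => r) (star a), coeffEmb_mem_semicrossedProduct _⟩ * y, ?_⟩
  change _ = _ * G x
  rw [← hy, LinearMap.comp_apply, hG, semicrossedRep_apply, semicrossedRep_apply,
    ← Matrix.star_eq_conjTranspose, ← map_star, ← map_mul]
  congr 1
  refine Subtype.ext ?_
  change unitaryRestriction σ (coeffEmb σ (fun r => r) (star a) * (y : Bdd _))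
    = star (unitaryRestriction σ (genWord σ (fun r => r) w * coeffEmb σ (fun r => r) a))
      * unitaryRestriction σ (L y : Bdd _)
  rw [hU, map_mul, map_mul, star_mul, unitaryRestriction_genWord, unitaryRestriction_coeffEmb,
    unitaryRestriction_coeffEmb, coeffEmb_star, mul_assoc, ← mul_assoc (star (genWord _ _ _)),
    star_genWord_mul_self, one_mul]

theorem isClosed_range_semicrossedRep (ρ : crossedProduct σ →⋆ₙₐ[ℂ] Matrix (Fin k) (Fin k) ℂ) :
    IsClosed (LinearMap.range (semicrossedRep ρ : semicrossedProduct σ →ₗ[ℂ] Matrix (Fin k) (Fin k) ℂ) :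
      Set (Matrix (Fin k) (Fin k) ℂ)) :=
  Submodule.closed_of_finiteDimensional _

theorem continuous_coeffEmb {J : Type*} (r : J → CovariantRep σ) : Continuous (coeffEmb σ r) := by
  let ι : A →⋆ₙₐ[ℂ] Bdd (fun j => (r j).toContractionTuple) :=
    { toFun := coeffEmb σ r
      map_smul' := fun c a => bdd_ext fun j => map_smul (r j).π c a
      map_zero' := bdd_ext fun j => map_zero (r j).π
      map_add' := fun a b => bdd_ext fun j => map_add (r j).π a b
      map_mul' := coeffEmb_mul r
      map_star' := coeffEmb_star r }
  exact AddMonoidHomClass.continuous_of_bound ι 1 fun a => by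
    rw [one_mul]; exact NonUnitalStarAlgHom.norm_apply_le ι a

/-- `ρ (U_w a)ᴴ` is the limit of `ρ (U_w e a)ᴴ = ρ (U_w a)ᴴ ρ (b*)` along an approximate unit `e`,
where `b` is the coefficient that becomes `e` when moved past `U_w`. -/
theorem conjTranspose_genWord_mem_range
    (ρ : crossedProduct σ →⋆ₙₐ[ℂ] Matrix (Fin k) (Fin k) ℂ) (w : FreeMonoid (Fin n)) (a : A) :
    (semicrossedRep ρ ⟨_, genWord_mul_coeffEmb_mem w a⟩).conjTranspose
      ∈ LinearMap.range (semicrossedRep ρ : semicrossedProduct σ →ₗ[ℂ] Matrix (Fin k) (Fin k) ℂ) := by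
  let : PartialOrder A := CStarAlgebra.spectralOrder A
  have : StarOrderedRing A := CStarAlgebra.spectralOrderedRing A
  have happ := (CStarAlgebra.increasingApproximateUnit A).toIsApproximateUnit
  have hne := happ.neBot
  obtain ⟨τ, hτ⟩ := exists_coeffEmb_mul_genWord (fun r : CovariantRep σ => r) w
  have hcont : Continuous fun b : A =>
      (semicrossedRep ρ ⟨_, genWord_mul_coeffEmb_mem w b⟩).conjTranspose := by
    refine ((continuous_semicrossedRep ρ).comp (Continuous.subtype_mk ?_ _)).matrix_conjTranspose
    exact continuous_const.mul (continuous_coeffEmb _)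
  have hlim := (hcont.tendsto a).comp (happ.tendsto_mul_right a)
  refine (isClosed_range_semicrossedRep ρ).mem_of_tendsto hlim (Eventually.of_forall fun e => ?_)
  obtain ⟨y, hy⟩ := conjTranspose_genWord_mul_mem_range ρ w a
    ⟨coeffEmb σ (fun r => r) (star (τ.symm e)), coeffEmb_mem_semicrossedProduct _⟩
  refine ⟨y, hy.trans ?_⟩
  change _ = (semicrossedRep ρ ⟨_, genWord_mul_coeffEmb_mem w (e * a)⟩).conjTranspose
  rw [semicrossedRep_apply, semicrossedRep_apply, semicrossedRep_apply,
    ← Matrix.star_eq_conjTranspose, ← Matrix.star_eq_conjTranspose, ← map_star ρ,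
    ← map_star ρ, ← map_mul ρ]
  congr 1
  refine Subtype.ext ?_
  change star (unitaryRestriction σ (genWord σ (fun r => r) w * coeffEmb σ (fun r => r) a))
      * unitaryRestriction σ (coeffEmb σ (fun r => r) (star (τ.symm e)))
    = star (unitaryRestriction σ (genWord σ (fun r => r) w * coeffEmb σ (fun r => r) (e * a)))
  rw [coeffEmb_star, map_star, ← star_mul, ← map_mul, ← mul_assoc, hτ, coeffEmb_mul, mul_assoc,
    StarAlgEquiv.apply_symm_apply]

theorem exists_semicrossedRep_eq_conjTranspose
    (ρ : crossedProduct σ →⋆ₙₐ[ℂ] Matrix (Fin k) (Fin k) ℂ) (x : semicrossedProduct σ) :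
    ∃ y, semicrossedRep ρ y = (semicrossedRep ρ x).conjTranspose := by
  suffices h : x ∈ {x | (semicrossedRep ρ x).conjTranspose
      ∈ LinearMap.range (semicrossedRep ρ : semicrossedProduct σ →ₗ[ℂ] Matrix (Fin k) (Fin k) ℂ)} from h
  have hcl : IsClosed {x | (semicrossedRep ρ x).conjTranspose
      ∈ LinearMap.range (semicrossedRep ρ : semicrossedProduct σ →ₗ[ℂ] Matrix (Fin k) (Fin k) ℂ)} :=
    (isClosed_range_semicrossedRep ρ).preimage (continuous_semicrossedRep ρ).matrix_conjTranspose
  let P : NonUnitalSubalgebra ℂ (Bdd (fun r : CovariantRep σ => r.toContractionTuple)) :=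
    NonUnitalAlgebra.adjoin ℂ {x | ∃ (w : FreeMonoid (Fin n)) (a : A),
      x = genWord σ (fun r : CovariantRep σ => r) w * coeffEmb σ (fun r : CovariantRep σ => r) a}
  have hP : P ≤ semicrossedProduct σ := NonUnitalSubalgebra.le_topologicalClosure _
  have hx : x ∈ closure {y : semicrossedProduct σ | (y : Bdd _) ∈ P} := by
    refine closure_subtype.2 ?_
    have himg : Subtype.val '' {y : semicrossedProduct σ | (y : Bdd _) ∈ P} = (P : Set (Bdd _)) := by
      ext z
      exact ⟨fun ⟨y, hy, h⟩ => h ▸ hy, fun hz => ⟨⟨z, hP hz⟩, hz, rfl⟩⟩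
    rw [himg]
    exact x.2
  refine closure_minimal (fun y hy => ?_) hcl hx
  obtain ⟨y, hyS⟩ := y
  change y ∈ P at hy
  induction hy using NonUnitalAlgebra.adjoin_induction with
  | mem y hy =>
    obtain ⟨w, a, rfl⟩ := hy
    exact conjTranspose_genWord_mem_range ρ w a
  | add y z hyP hzP hy hz =>
    have h : semicrossedRep ρ ⟨y + z, hyS⟩ = semicrossedRep ρ ⟨y, hP hyP⟩
      + semicrossedRep ρ ⟨z, hP hzP⟩ := map_add (semicrossedRep ρ) ⟨y, hP hyP⟩ ⟨z, hP hzP⟩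
    rw [Set.mem_ofPred_eq, h, Matrix.conjTranspose_add]
    exact add_mem (hy (hP hyP)) (hz (hP hzP))
  | zero =>
    have h : semicrossedRep ρ ⟨0, hyS⟩ = 0 := map_zero (semicrossedRep ρ)
    rw [Set.mem_ofPred_eq, h, Matrix.conjTranspose_zero]
    exact zero_mem _
  | mul y z hyP hzP hy hz =>
    have h : semicrossedRep ρ ⟨y * z, hyS⟩ = semicrossedRep ρ ⟨y, hP hyP⟩
      * semicrossedRep ρ ⟨z, hP hzP⟩ := map_mul (semicrossedRep ρ) ⟨y, hP hyP⟩ ⟨z, hP hzP⟩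
    rw [Set.mem_ofPred_eq, h, Matrix.conjTranspose_mul]
    obtain ⟨y', hy'⟩ := hy (hP hyP)
    obtain ⟨z', hz'⟩ := hz (hP hzP)
    rw [← hy', ← hz']
    exact ⟨z' * y', map_mul (semicrossedRep ρ) z' y'⟩
  | smul c y hyP hy =>
    have h : semicrossedRep ρ ⟨c • y, hyS⟩ = c • semicrossedRep ρ ⟨y, hP hyP⟩ :=
      map_smul (semicrossedRep ρ) c ⟨y, hP hyP⟩
    rw [Set.mem_ofPred_eq, h, Matrix.conjTranspose_smul]
    exact Submodule.smul_mem _ _ (hy (hP hyP))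

theorem semicrossedProduct_isDerivation (hRFD : IsRFD (crossedProduct σ))
    {δ : semicrossedProduct σ →L[ℂ] semicrossedProduct σ} (hδ : IsApproxLocalDerivation δ) :
    IsDerivation δ := by
  have : CompleteSpace (semicrossedProduct σ) :=
    (NonUnitalSubalgebra.isClosed_topologicalClosure _).completeSpace_coe
  refine hδ.isDerivation fun x hx => ?_
  obtain ⟨k, ρ, hρ⟩ := hRFD ⟨unitaryRestriction σ x, unitaryRestriction_mem x.2⟩ fun h =>
    unitaryRestriction_ne_zero x.2 (fun h0 => hx (Subtype.ext h0)) (congrArg Subtype.val h)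
  exact ⟨k, semicrossedRep ρ, continuous_semicrossedRep ρ,
    exists_semicrossedRep_eq_conjTranspose ρ, hρ⟩

end Semicrossed

end

theorem proposition4p13 (n : ℕ) :
    (∀ (A : Type u) [NonUnitalCStarAlgebra A] (σ : Fin n → (A ≃⋆ₐ[ℂ] A)),
      IsRFD (crossedProduct σ) →
        ∀ δ : semicrossedProduct σ →L[ℂ] semicrossedProduct σ,
          IsApproxLocalDerivation δ → IsDerivation δ) ∧
    (∀ δ : freeSemigroupAlgebra n →L[ℂ] freeSemigroupAlgebra n,
      IsApproxLocalDerivation δ → IsDerivation δ) ∧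
    (∀ δ : universalContractionAlgebra n →L[ℂ] universalContractionAlgebra n,
      IsApproxLocalDerivation δ → IsDerivation δ) :=
  ⟨fun _ _ _ hRFD _ hδ => semicrossedProduct_isDerivation hRFD hδ,
    fun _ hδ => freeSemigroupAlgebra_isDerivation hδ,
    fun _ hδ => universalContractionAlgebra_isDerivation hδ⟩
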